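/- Let $\mathcal A$ be a finite arrangement of distinct affine hyperplanes in $\mathbb C^\ell$. For each $H\in\mathcal A$ let $\alpha_H$ be a polynomial of degree one whose zero set is $H$, and let $f=\prod_{H\in\mathcal A}\alpha_H$ be the resulting defining polynomial. Let $M(\mathcal A)=\mathbb C^\ell\setminus\bigcup_{H\in\mathcal A}H$ be the complement, with base point $\mathbf x_0$. For an integer $m\ge 1$ let $$X_m(\mathcal A)=\{(\mathbf x,z)\in M(\mathcal A)\times\mathbb C^*\mid f(\mathbf x)=z^m\}.$$ A meridian loop $\gamma_H$ about $H\in\mathcal A$ is the class in $\pi_1(M(\mathcal A),\mathbf x_0)$ of a loop that follows a path in $M(\mathcal A)$ from $\mathbf x_0$ to the boundary of a disc in a complex line transverse to $H$, runs once around that boundary in the positive direction, and returns along the same path, where the disc meets the union of the hyperplanes only in its centre, a point that lies on $H$ and on no other hyperplane. For every divisor $k$ of $m$ there is exactly one homomorphism $\tau^k_1:\pi_1(M(\mathcal A),\mathbf x_0)\to\mathbb C^*$ such that $\tau^k_1(\gamma_H)=\exp(2\pi i/k)$ for every meridian loop $\gamma_H$ about every $H\in\mathcal A$. Let $\mathcal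 L^k_1$ be the complex rank one local system on $M(\mathcal A)$ induced by $\tau^k_1$. Then for every $q\ge 0$ the Betti number $b_q(X_m(\mathcal A))=\dim_{\mathbb C}H^q(X_m(\mathcal A);\mathbb C)$ is given by $$b_q(X_m(\mathcal A))=\sum_{k\mid m}\phi(k)\cdot\dim_{\mathbb C}H^q(M(\mathcal A);\mathcal L^k_1),$$ where $\phi$ is the Euler phi function. -/

import Mathlib

open CategoryTheory Simplicial

noncomputable section

namespace CyclicCover

/-! ### Local systems and their cohomology -/

/-- A complex local system on `X`: a functor from the fundamental groupoid of `X` to complex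
vector spaces (a stalk at every point, and transport isomorphisms along homotopy classes of
paths). -/
abbrev LocalSystem (X : Type) [TopologicalSpace X] := FundamentalGroupoid X ⥤ ModuleCat.{0} ℂ

/-- The constant local system with stalk `ℂ`. -/
def constantSystem (X : Type) [TopologicalSpace X] : LocalSystem X :=
  (Functor.const (FundamentalGroupoid X)).obj (ModuleCat.of ℂ ℂ)

section Induced

variable {X : Type} [TopologicalSpace X] {x₀ : X} (τ : FundamentalGroup X x₀ →* ℂˣ)

/-- The stalk at `x` of the local system induced by the character `τ` of `π₁(X, x₀)`: functions
`s` on the homotopy classes of paths from `x₀` to `x` (the fibre of the universal cover over `x`)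
that satisfy `s (g · p) = τ(g)⁻¹ s(p)` for every loop `g` at `x₀`. -/
def inducedStalk (x : FundamentalGroupoid X) :
    Submodule ℂ ((FundamentalGroupoid.mk x₀ ⟶ x) → ℂ) where
  carrier := {s | ∀ (g : FundamentalGroupoid.mk x₀ ⟶ FundamentalGroupoid.mk x₀)
    (p : FundamentalGroupoid.mk x₀ ⟶ x),
      s (g ≫ p) = ((τ g)⁻¹ : ℂˣ) * s p}
  add_mem' {s t} hs ht g p := by
    simp only [Pi.add_apply, hs g p, ht g p, mul_add]
  zero_mem' g p := by simp
  smul_mem' c s hs g p := by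
    simp only [Pi.smul_apply, smul_eq_mul, hs g p]
    ring

/-- Transport of a stalk element along `γ : x ⟶ y`, `(γ s)(p) = s(p · γ⁻¹)`. -/
def inducedTransport {x y : FundamentalGroupoid X} (γ : x ⟶ y) :
    inducedStalk τ x →ₗ[ℂ] inducedStalk τ y where
  toFun s := ⟨fun p => s.1 (p ≫ Groupoid.inv γ), fun g p => by
    change s.1 ((g ≫ p) ≫ Groupoid.inv γ) = _
    rw [Category.assoc]
    exact s.2 g (p ≫ Groupoid.inv γ)⟩
  map_add' _ _ := rfl
  map_smul' _ _ := rfl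

/-- The rank one local system on `X` induced by the character `τ` of `π₁(X, x₀)`. -/
def inducedSystem : LocalSystem X where
  obj x := ModuleCat.of ℂ (inducedStalk τ x)
  map γ := ModuleCat.ofHom (inducedTransport τ γ)
  map_id x := by
    ext s p
    change s.1 (p ≫ Groupoid.inv (𝟙 x)) = s.1 p
    simp
  map_comp {x y z} γ δ := by
    ext s p
    change s.1 (p ≫ Groupoid.inv (γ ≫ δ)) = s.1 ((p ≫ Groupoid.inv δ) ≫ Groupoid.inv γ)
    simp

end Induced

/-- The standard topological `n`-simplex. -/
abbrev Simplex (n : SimplexCategory) : Type := stdSimplex ℝ (Fin (n.len + 1))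

/-- The affine map of standard simplices given by a monotone map of vertices. -/
def simplexMap {m n : SimplexCategory} (θ : m ⟶ n) : C(Simplex m, Simplex n) :=
  ⟨stdSimplex.map θ, stdSimplex.continuous_map θ⟩

/-- The vertex `e₀`. -/
def vertexZero (n : SimplexCategory) : Simplex n :=
  ⟨Pi.single 0 1, single_mem_stdSimplex ℝ 0⟩

instance contractibleSpace_simplex (n : SimplexCategory) : ContractibleSpace (Simplex n) :=
  (convex_stdSimplex ℝ (Fin (n.len + 1))).contractibleSpace ⟨_, single_mem_stdSimplex ℝ 0⟩

/-- The homotopy class of paths from `s` to `t` in a simplex; it is the only one, as a simplex is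
simply connected. -/
def simplexPath {n : SimplexCategory} (s t : Simplex n) :
    FundamentalGroupoid.mk s ⟶ FundamentalGroupoid.mk t :=
  FundamentalGroupoid.fromPath (Path.Homotopic.Quotient.mk (PathConnectedSpace.somePath s t))

lemma simplex_hom_eq {n : SimplexCategory} {s t : FundamentalGroupoid (Simplex n)}
    (p q : s ⟶ t) : p = q :=
  Subsingleton.elim (α := Path.Homotopic.Quotient s.as t.as) p q

section Cochains

variable {X : Type} [TopologicalSpace X] (L : LocalSystem X)

/-- Transport of `L` along the image under the singular simplex `σ` of the path from `s` to `t`. -/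
def simplexTransport {n : SimplexCategory} (σ : C(Simplex n, X)) (s t : Simplex n) :
    L.obj (FundamentalGroupoid.mk (σ s)) ⟶ L.obj (FundamentalGroupoid.mk (σ t)) :=
  (FundamentalGroupoid.map σ ⋙ L).map (simplexPath s t)

lemma simplexTransport_self {n : SimplexCategory} (σ : C(Simplex n, X)) (s : Simplex n) :
    simplexTransport L σ s s = 𝟙 _ := by
  unfold simplexTransport
  rw [simplex_hom_eq (simplexPath s s) (𝟙 _)]
  exact (FundamentalGroupoid.map σ ⋙ L).map_id _

lemma simplexTransport_comp {n : SimplexCategory} (σ : C(Simplex n, X)) (s t u : Simplex n) :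
    simplexTransport L σ s t ≫ simplexTransport L σ t u = simplexTransport L σ s u := by
  unfold simplexTransport
  rw [simplex_hom_eq (simplexPath s u) (simplexPath s t ≫ simplexPath t u)]
  exact ((FundamentalGroupoid.map σ ⋙ L).map_comp _ _).symm

lemma simplexTransport_simplexMap {m n : SimplexCategory} (θ : m ⟶ n) (σ : C(Simplex n, X))
    (s t : Simplex m) :
    simplexTransport L (σ.comp (simplexMap θ)) s t =
      simplexTransport L σ (simplexMap θ s) (simplexMap θ t) := by
  unfold simplexTransport
  rw [simplex_hom_eq (simplexPath (simplexMap θ s) (simplexMap θ t))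
    ((FundamentalGroupoid.map (simplexMap θ)).map (simplexPath s t))]
  generalize simplexPath s t = γ
  induction γ using Quotient.ind
  rfl

/-- Singular `n`-cochains of `X` with coefficients in `L`: a function that assigns to every
singular simplex `σ` an element of the stalk of `L` at `σ(e₀)`. -/
abbrev Cochain (n : SimplexCategory) : Type :=
  (σ : C(Simplex n, X)) → L.obj (FundamentalGroupoid.mk (σ (vertexZero n)))

/-- The map of cochains given by a monotone map `θ` of vertices: evaluate on `σ ∘ θ`, and
transport the value from `σ(e_{θ(0)})` to `σ(e₀)`. -/
def cochainMap {m n : SimplexCategory} (θ : m ⟶ n) : Cochain L m →ₗ[ℂ] Cochain L n where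
  toFun c σ := simplexTransport L σ (simplexMap θ (vertexZero m)) (vertexZero n)
    (c (σ.comp (simplexMap θ)))
  map_add' c d := by
    funext σ
    exact map_add (simplexTransport L σ (simplexMap θ (vertexZero m)) (vertexZero n)).hom _ _
  map_smul' a c := by
    funext σ
    exact map_smul (simplexTransport L σ (simplexMap θ (vertexZero m)) (vertexZero n)).hom _ _

lemma cochainMap_id {n : SimplexCategory} (c : Cochain L n) : cochainMap L (𝟙 n) c = c := by
  funext σ
  have h : simplexMap (𝟙 n) = ContinuousMap.id (Simplex n) := by
    ext1 x
    exact stdSimplex.map_id_apply x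
  change (simplexTransport L σ (simplexMap (𝟙 n) (vertexZero n)) (vertexZero n)).hom
    (c (σ.comp (simplexMap (𝟙 n)))) = c σ
  rw [h]
  change (simplexTransport L σ (vertexZero n) (vertexZero n)).hom (c σ) = c σ
  rw [simplexTransport_self]
  rfl

lemma cochainMap_comp {m n k : SimplexCategory} (θ : m ⟶ n) (η : n ⟶ k) (c : Cochain L m) :
    cochainMap L (θ ≫ η) c = cochainMap L η (cochainMap L θ c) := by
  funext σ
  have h : simplexMap (θ ≫ η) = (simplexMap η).comp (simplexMap θ) := by
    ext1 x
    exact (stdSimplex.map_comp_apply θ η x).symm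
  change (simplexTransport L σ (simplexMap (θ ≫ η) (vertexZero m)) (vertexZero k)).hom
      (c (σ.comp (simplexMap (θ ≫ η)))) =
    (simplexTransport L σ (simplexMap η (vertexZero n)) (vertexZero k)).hom
      ((simplexTransport L (σ.comp (simplexMap η)) (simplexMap θ (vertexZero m))
        (vertexZero n)).hom (c ((σ.comp (simplexMap η)).comp (simplexMap θ))))
  rw [h, simplexTransport_simplexMap]
  change (simplexTransport L σ (simplexMap η (simplexMap θ (vertexZero m))) (vertexZero k)).hom
    (c (σ.comp ((simplexMap η).comp (simplexMap θ)))) = _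
  rw [← simplexTransport_comp L σ (simplexMap η (simplexMap θ (vertexZero m)))
      (simplexMap η (vertexZero n)) (vertexZero k)]
  rfl

/-- The cosimplicial vector space of singular cochains of `X` with coefficients in `L`. -/
def cochains : CosimplicialObject (ModuleCat.{0} ℂ) where
  obj n := ModuleCat.of ℂ (Cochain L n)
  map θ := ModuleCat.ofHom (cochainMap L θ)
  map_id n := by
    ext1
    exact LinearMap.ext fun c => cochainMap_id L c
  map_comp θ η := by
    ext1
    exact LinearMap.ext fun c => cochainMap_comp L θ η c

/-- The singular cohomology `H^q(X; L)`: the cohomology of the singular cochain complex, whose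
differential is the alternating sum of the coface maps. -/
def cohomology (q : ℕ) : ModuleCat.{0} ℂ :=
  ((AlgebraicTopology.alternatingCofaceMapComplex (ModuleCat.{0} ℂ)).obj (cochains L)).homology q

end Cochains

/-- The `q`-th Betti number `b_q(L) = dim_ℂ H^q(X; L)`, as a cardinal. -/
def bettiLocal {X : Type} [TopologicalSpace X] (L : LocalSystem X) (q : ℕ) : Cardinal.{0} :=
  Module.rank ℂ (cohomology L q)

/-- The `q`-th Betti number `b_q(X) = dim_ℂ H^q(X; ℂ)`, as a cardinal. -/
def betti (X : Type) [TopologicalSpace X] (q : ℕ) : Cardinal.{0} :=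
  bettiLocal (constantSystem X) q

/-! ### Arrangements -/

/-- A finite arrangement of distinct affine hyperplanes in `ℂ^ℓ`, each given by a polynomial of
degree one (a non-constant affine form) that vanishes exactly on it. -/
structure Arrangement (ι : Type) (ℓ : ℕ) where
  /-- the defining polynomial of degree one of each hyperplane -/
  form : ι → ((Fin ℓ → ℂ) →ᵃ[ℂ] ℂ)
  form_linear_ne_zero : ∀ i, (form i).linear ≠ 0
  hyperplane_injective : Function.Injective fun i => {x | form i x = 0}

namespace Arrangement

variable {ι : Type} {ℓ : ℕ} (A : Arrangement ι ℓ)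

/-- The hyperplane with index `i`. -/
def hyperplane (i : ι) : Set (Fin ℓ → ℂ) := {x | A.form i x = 0}

/-- The complement `M(A)` of the union of the hyperplanes. -/
def complement : Set (Fin ℓ → ℂ) := (⋃ i, A.hyperplane i)ᶜ

/-- The defining polynomial (function) `f = Q(A)`, the product of the forms. -/
def Q [Fintype ι] (x : Fin ℓ → ℂ) : ℂ := ∏ i, A.form i x

/-- The cyclic cover `X_m(A) = {(x, z) ∈ M(A) × ℂ^* | f(x) = z^m}`. -/
def cover [Fintype ι] (m : ℕ) : Set ((Fin ℓ → ℂ) × ℂ) :=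
  {p | p.1 ∈ A.complement ∧ p.2 ≠ 0 ∧ A.Q p.1 = p.2 ^ m}

/-- `g ∈ π₁(M(A), x₀)` is the class of a meridian loop about the hyperplane `H = H_i`: there is a
disc `{p + t v : |t| ≤ 1}` in a complex line transverse to `H` that meets the arrangement only in
its centre `p`, a point of `H` and of no other hyperplane; the loop goes along a path `δ` in
`M(A)` from `x₀` to the boundary of the disc, once around the boundary circle `p + e^{2πis} v`
in the positive direction, and back along `δ`. -/
def IsMeridian (x₀ : A.complement) (i : ι) (g : FundamentalGroup A.complement x₀) : Prop :=
  ∃ (p v : Fin ℓ → ℂ) (y : A.complement) (δ : Path x₀ y) (σ : Path y y),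
    p ∈ A.hyperplane i ∧ (A.form i).linear v ≠ 0 ∧
    (∀ j, j ≠ i → ∀ t : ℂ, ‖t‖ ≤ 1 → p + t • v ∉ A.hyperplane j) ∧
    (∀ s : unitInterval, (σ s : Fin ℓ → ℂ) =
      p + Complex.exp (2 * Real.pi * Complex.I * (s : ℝ)) • v) ∧
    g = FundamentalGroup.fromPath
      (Path.Homotopic.Quotient.mk ((δ.trans σ).trans δ.symm))

/-- The character `τ` of `π₁(M(A), x₀)` sends every meridian loop about every hyperplane
to `exp(2πi/k)`. -/
def IsMeridianCharacter (x₀ : A.complement) (k : ℕ)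
    (τ : FundamentalGroup A.complement x₀ →* ℂˣ) : Prop :=
  ∀ (i : ι) (g : FundamentalGroup A.complement x₀), A.IsMeridian x₀ i g →
    (τ g : ℂ) = Complex.exp (2 * Real.pi * Complex.I / k)

end Arrangement

end CyclicCover

end

/-! The projection `X_m(A) → M(A)` is a Galois covering with group `μ_m`, acting on the coordinate
`z`. Singular cochains of the cover split into eigenspaces of this group. A cochain of weight `j`
descends to a cochain of `M(A)` with values in the local system of `χ^j`, where `χ` is the monodromy
character of the `m`-th roots of `f`. The splitting respects the cosimplicial structure, so
`b_q(X_m)` is the sum of `b_q(χ^j)` over `0 ≤ j < m` (`betti_cover_eq_sum`).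

To collect the terms by divisors, let `k = m / gcd(m, j)`. The numbers `ζ_m^j` and `ζ_m^(m/k)` are
both primitive `k`-th roots of unity, hence exchanged by a field automorphism of `ℂ`. Applied to the
values of cochains, it is a semilinear isomorphism of cochain complexes and preserves dimensions
(`bettiLocal_powSystem_eq_of_gcd_eq`). Each `k` occurs `φ(k)` times.

It remains to see that `χ^(m/k)` is the only character with value `exp(2πi/k)` on meridians. Its
value comes from an explicit root of `f` along a small circle (`exists_root_along_circle`). For
uniqueness, a character trivial on meridians must be trivial (`val_loop_eq_one`). A loop is cut into
short pieces, and each piece is coned off from one generic point `c`. By general position the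
triangles miss all intersections of two hyperplanes, so the character is given by a flat function
near every point of a triangle: by contractibility off the hyperplanes, by triviality on meridians
on a single hyperplane (`flatNear_of_mem_hyperplane`). These local functions glue over each
triangle, and the product around the loop telescopes to one. -/

open CategoryTheory Simplicial

noncomputable section

namespace CyclicCover

/-! ### Analytic continuation of `m`-th roots of a nowhere vanishing function -/

section RootTransport

/-- The punctured complex plane. -/
abbrev PuncturedPlane : Type := {z : ℂ // z ≠ 0}

lemma PuncturedPlane.ne_zero (z : PuncturedPlane) : (z : ℂ) ≠ 0 := z.2

/-- The power map of the punctured plane. -/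
def powMap (m : ℕ) (z : PuncturedPlane) : PuncturedPlane := ⟨(z : ℂ) ^ m, pow_ne_zero m z.2⟩

lemma isCoveringMap_powMap {m : ℕ} (hm : 0 < m) : IsCoveringMap (powMap m) :=
  isCoveringMap_npow (𝕜 := ℂ) m (Nat.cast_ne_zero.2 hm.ne')

lemma powMap_surjective {m : ℕ} (hm : 0 < m) (w : PuncturedPlane) : ∃ z, powMap m z = w := by
  obtain ⟨z, hz⟩ := IsAlgClosed.exists_pow_nat_eq (w : ℂ) hm
  refine ⟨⟨z, fun h => w.2 ?_⟩, Subtype.ext hz⟩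
  rw [← hz, h, zero_pow hm.ne']

lemma _root_.IsCoveringMap.exists_lift_of_contractibleSpace {E X Y : Type*} [TopologicalSpace E]
    [TopologicalSpace X] [TopologicalSpace Y] [ContractibleSpace Y] {p : E → X}
    (cov : IsCoveringMap p) (hp : Function.Surjective p) (f : C(Y, X)) :
    ∃ F : C(Y, E), ∀ a, p (F a) = f a := by
  obtain ⟨y, ⟨H⟩⟩ := id_nullhomotopic Y
  obtain ⟨e, he⟩ := hp (f y)
  have h0 : ∀ a, (f.comp H.symm.toContinuousMap) (0, a) = p (ContinuousMap.const Y e a) := by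
    intro a
    simp [he]
  refine ⟨(cov.liftHomotopy _ _ h0).comp ((ContinuousMap.const Y 1).prodMk (.id Y)), fun a => ?_⟩
  have := congr_fun (cov.liftHomotopy_lifts _ _ h0) (1, a)
  simp only [Function.comp_apply] at this
  simpa using! this

variable {X : Type} [TopologicalSpace X] (f : C(X, PuncturedPlane)) {m : ℕ} (hm : 0 < m)

/-- A lift through `z ↦ z^m` multiplied by the constant `e' / e` is again a lift, and lifts are
unique. Hence continuation acts on all roots by one common factor, which makes `rootTransport`
independent of the chosen root. -/
lemma monodromy_powMap_proportional {x y : PuncturedPlane} (γ : Path.Homotopic.Quotient x y)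
    (e e' : powMap m ⁻¹' {x}) :
    (((isCoveringMap_powMap hm).monodromy γ e).1 : ℂ) * (e'.1 : ℂ) =
      (((isCoveringMap_powMap hm).monodromy γ e').1 : ℂ) * (e.1 : ℂ) := by
  obtain ⟨γ⟩ := γ
  have he : ((e.1 : PuncturedPlane) : ℂ) ^ m = x := congrArg Subtype.val e.2
  have he' : ((e'.1 : PuncturedPlane) : ℂ) ^ m = x := congrArg Subtype.val e'.2
  let Γ := (isCoveringMap_powMap hm).liftPath γ e (γ.source.trans e.2.symm)
  have hΓ : powMap m ∘ Γ = γ := (isCoveringMap_powMap hm).liftPath_lifts _ _ _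
  have hΓ0 : Γ 0 = e := (isCoveringMap_powMap hm).liftPath_zero _ _ _
  have hc : ((e'.1 : ℂ) / (e.1 : ℂ)) ≠ 0 := div_ne_zero e'.1.2 e.1.2
  let Γ' : C(unitInterval, PuncturedPlane) :=
    ⟨fun t => ⟨((e'.1 : ℂ) / (e.1 : ℂ)) * Γ t, mul_ne_zero hc (Γ t).2⟩, by fun_prop⟩
  have h : Γ' = (isCoveringMap_powMap hm).liftPath γ e' (γ.source.trans e'.2.symm) := by
    rw [IsCoveringMap.eq_liftPath_iff']
    refine ⟨funext fun t => ?_, ?_⟩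
    · rw [show (γ : C(unitInterval, PuncturedPlane)) t = (powMap m ∘ Γ) t from
        (congr_fun hΓ t).symm]
      apply Subtype.ext
      simp only [powMap, Function.comp_apply, Γ', ContinuousMap.coe_mk, mul_pow, div_pow, he, he']
      rw [div_self x.2, one_mul]
    · apply Subtype.ext
      simp only [Γ', ContinuousMap.coe_mk, hΓ0]
      exact div_mul_cancel₀ _ e.1.2
  change ((Γ 1 : PuncturedPlane) : ℂ) * _ =
    ((((isCoveringMap_powMap hm).liftPath γ e' (γ.source.trans e'.2.symm)) 1 :
      PuncturedPlane) : ℂ) * _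
  rw [← h]
  simp only [Γ', ContinuousMap.coe_mk]
  field_simp [e.1.2]

/-- A chosen `m`-th root. -/
def chosenRoot (w : PuncturedPlane) : powMap m ⁻¹' {w} :=
  ⟨(powMap_surjective hm w).choose, (powMap_surjective hm w).choose_spec⟩

/-- The factor by which `m`-th roots of a nowhere vanishing function `f` are multiplied by analytic
continuation along a homotopy class of paths. -/
def rootTransport {x y : FundamentalGroupoid X} (γ : x ⟶ y) : ℂˣ :=
  Units.mk0 ((((isCoveringMap_powMap hm).monodromy (Path.Homotopic.Quotient.map γ f)
      (chosenRoot hm (f x.as))).1 : ℂ) / ((chosenRoot hm (f x.as)).1 : ℂ))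
    (div_ne_zero (PuncturedPlane.ne_zero _) (PuncturedPlane.ne_zero _))

lemma monodromy_eq_rootTransport {x y : FundamentalGroupoid X} (γ : x ⟶ y)
    (e : powMap m ⁻¹' {f x.as}) :
    (((isCoveringMap_powMap hm).monodromy (Path.Homotopic.Quotient.map γ f) e).1 : ℂ) =
      rootTransport f hm γ * (e.1 : ℂ) := by
  have := monodromy_powMap_proportional hm (Path.Homotopic.Quotient.map γ f) e
    (chosenRoot hm (f x.as))
  rw [rootTransport, Units.val_mk0, div_mul_eq_mul_div, ← this,
    mul_div_cancel_right₀ _ (PuncturedPlane.ne_zero _)]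

lemma rootTransport_id (x : FundamentalGroupoid X) : rootTransport f hm (𝟙 x) = 1 := by
  apply Units.ext
  obtain ⟨e, he⟩ := powMap_surjective hm (f x.as)
  have h := monodromy_eq_rootTransport f hm (𝟙 x) ⟨e, he⟩
  have h1 : Path.Homotopic.Quotient.map (𝟙 x : x ⟶ x) f =
      Path.Homotopic.Quotient.refl (f x.as) := rfl
  rw [h1, IsCoveringMap.monodromy_refl] at h
  simpa [e.2] using! h.symm

lemma rootTransport_comp {x y z : FundamentalGroupoid X} (γ : x ⟶ y) (δ : y ⟶ z) :
    rootTransport f hm (γ ≫ δ) = rootTransport f hm γ * rootTransport f hm δ := by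
  apply Units.ext
  obtain ⟨e, he⟩ := powMap_surjective hm (f x.as)
  have h := monodromy_eq_rootTransport f hm (γ ≫ δ) ⟨e, he⟩
  have h1 : Path.Homotopic.Quotient.map (γ ≫ δ) f =
      (Path.Homotopic.Quotient.map γ f).trans (Path.Homotopic.Quotient.map δ f) := by
    obtain ⟨γ⟩ := γ
    obtain ⟨δ⟩ := δ
    exact congrArg _ (Path.map_trans γ δ f.continuous)
  rw [h1, IsCoveringMap.monodromy_trans_apply, monodromy_eq_rootTransport,
    monodromy_eq_rootTransport] at h
  have := mul_right_cancel₀ e.ne_zero ((mul_assoc _ _ _).trans h)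
  rw [← this, Units.val_mul, mul_comm]

lemma rootTransport_inv {x y : FundamentalGroupoid X} (γ : x ⟶ y) :
    rootTransport f hm (Groupoid.inv γ) = (rootTransport f hm γ)⁻¹ := by
  rw [eq_inv_iff_mul_eq_one, ← rootTransport_comp, Groupoid.inv_comp, rootTransport_id]

/-- A global root `z` of `f ∘ p` restricts along any path to the lift that computes the
continuation. On the cyclic cover such a root exists, so the monodromy becomes a coboundary there.
-/
lemma rootTransport_map {Y : Type} [TopologicalSpace Y] (p : C(Y, X)) (z : C(Y, PuncturedPlane))
    (hz : ∀ y, powMap m (z y) = f (p y)) {a b : FundamentalGroupoid Y} (γ : a ⟶ b) :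
    (rootTransport f hm ((FundamentalGroupoid.map p).map γ) : ℂ) * (z a.as : ℂ) = z b.as := by
  refine (monodromy_eq_rootTransport f hm ((FundamentalGroupoid.map p).map γ)
    ⟨z a.as, hz a.as⟩).symm.trans ?_
  have := (isCoveringMap_powMap hm).monodromy_eq_of_map_eq
    (γ := Path.Homotopic.Quotient.map ((FundamentalGroupoid.map p).map γ) f)
    (ex := ⟨z a.as, hz a.as⟩) (ey := ⟨z b.as, hz b.as⟩) (Path.Homotopic.Quotient.map γ z) (by
      obtain ⟨γ⟩ := γ
      refine congrArg Path.Homotopic.Quotient.mk ?_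
      apply Path.ext
      funext t
      exact hz _)
  exact congrArg (fun w => ((w.1 : PuncturedPlane) : ℂ)) this

lemma rootTransport_pow {x y : FundamentalGroupoid X} (γ : x ⟶ y) :
    (rootTransport f hm γ : ℂ) ^ m * f x.as = f y.as := by
  obtain ⟨e, he⟩ := powMap_surjective hm (f x.as)
  have h := congrArg (· ^ m) (monodromy_eq_rootTransport f hm γ ⟨e, he⟩)
  have h2 := ((isCoveringMap_powMap hm).monodromy (Path.Homotopic.Quotient.map γ f) ⟨e, he⟩).2
  have h3 := congrArg Subtype.val h2
  have h4 := congrArg Subtype.val he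
  simp only [powMap] at h3 h4
  rw [h3, mul_pow, h4] at h
  exact h.symm

/-- The character of the fundamental group describing the monodromy of `m`-th roots of `f`. -/
def rootCharacter (x₀ : X) : FundamentalGroup X x₀ →* ℂˣ where
  toFun g := rootTransport f hm g
  map_one' := rootTransport_id f hm _
  -- The product `g * h` is the composite `h ≫ g`; commutativity of `ℂˣ` absorbs the reversal.
  map_mul' g h := (rootTransport_comp f hm h g).trans (mul_comm _ _)

lemma rootCharacter_pow (x₀ : X) (g : FundamentalGroup X x₀) : rootCharacter f hm x₀ g ^ m = 1 := by
  apply Units.ext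
  have := rootTransport_pow f hm (x := .mk x₀) (y := .mk x₀) g
  exact mul_right_cancel₀ (f x₀).ne_zero (this.trans (one_mul _).symm)

end RootTransport

/-! ### Direct sum decompositions and ranks of cohomology -/

section Additive

/-- The cohomology of the alternating coface complex, as a functor. -/
def cosimplicialCohomology (q : ℕ) :
    CosimplicialObject (ModuleCat.{0} ℂ) ⥤ ModuleCat.{0} ℂ :=
  AlgebraicTopology.alternatingCofaceMapComplex (ModuleCat.{0} ℂ) ⋙
    HomologicalComplex.homologyFunctor (ModuleCat.{0} ℂ) (ComplexShape.up ℕ) q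

instance : Preadditive (CosimplicialObject (ModuleCat.{0} ℂ)) :=
  inferInstanceAs (Preadditive (SimplexCategory ⥤ ModuleCat.{0} ℂ))

instance : (AlgebraicTopology.alternatingCofaceMapComplex (ModuleCat.{0} ℂ)).Additive where
  map_add := by
    intros
    ext n : 1
    rfl

instance (q : ℕ) : (cosimplicialCohomology q).Additive := by
  unfold cosimplicialCohomology
  infer_instance

lemma bettiLocal_eq {X : Type} [TopologicalSpace X] (L : LocalSystem X) (q : ℕ) :
    bettiLocal L q = Module.rank ℂ ((cosimplicialCohomology q).obj (cochains L)) := rfl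

lemma cardinal_sum_eq_finset_sum {J : Type} [h : Fintype J] (f : J → Cardinal.{0}) :
    Cardinal.sum f = ∑ j, f j := by
  revert f
  refine Fintype.induction_empty_option ?_ ?_ ?_ J (h_fintype := h)
  · intro α β hβ e h f
    let := Fintype.ofEquiv β e.symm
    rw [← e.sum_comp f, ← h]
    exact Cardinal.mk_congr (e.sigmaCongrLeft (β := fun i => (f i).out)).symm
  · intro f
    rw [Fintype.univ_pempty, Finset.sum_empty, Cardinal.sum, Cardinal.mk_eq_zero]
  · intro α hα h f
    rw [Fintype.sum_option, ← h, Cardinal.sum, Cardinal.sum,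
      Cardinal.mk_congr ((Equiv.optionEquivSumPUnit.{0} α).symm.sigmaCongrLeft
        (β := fun i => (f i).out)).symm, Cardinal.mk_congr (Equiv.sumSigmaDistrib _),
      Cardinal.mk_sum, Cardinal.lift_id, Cardinal.lift_id, add_comm]
    congr 1
    rw [Cardinal.mk_congr (Equiv.uniqueSigma _)]
    exact Cardinal.mk_out _

lemma rank_eq_sum_of_decomposition {J : Type} [Fintype J] [DecidableEq J] {V : ModuleCat.{0} ℂ}
    {W : J → ModuleCat.{0} ℂ} (a : ∀ j, W j ⟶ V) (b : ∀ j, V ⟶ W j)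
    (hab : ∀ j, a j ≫ b j = 𝟙 _) (hne : ∀ j k, j ≠ k → a j ≫ b k = 0)
    (htot : ∑ j, b j ≫ a j = 𝟙 V) :
    Module.rank ℂ V = ∑ j, Module.rank ℂ (W j) := by
  have e : V ≃ₗ[ℂ] (∀ j, W j) :=
    LinearEquiv.ofLinearMap (LinearMap.pi fun j => (b j).hom)
      (∑ j, (a j).hom ∘ₗ LinearMap.proj j)
      (by
        refine LinearMap.ext fun w => funext fun k => ?_
        have h : ∀ j, (b k).hom ((a j).hom (w j)) = if j = k then w k else 0 := by
          intro j
          split_ifs with hjk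
          · subst hjk
            exact LinearMap.congr_fun (congrArg ModuleCat.Hom.hom (hab j)) (w j)
          · exact LinearMap.congr_fun (congrArg ModuleCat.Hom.hom (hne j k hjk)) (w j)
        simp [map_sum, h])
      (by
        refine LinearMap.ext fun v => ?_
        have := LinearMap.congr_fun (congrArg ModuleCat.Hom.hom htot) v
        simpa [LinearMap.sum_apply, ModuleCat.hom_sum] using this)
  rw [e.rank_eq, rank_pi, cardinal_sum_eq_finset_sum]

/-- The three identities exhibit `V` as a biproduct of the `W j`, and an additive functor preserves
such identities. -/
lemma rank_cohomology_eq_sum {J : Type} [Fintype J] [DecidableEq J]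
    {V : CosimplicialObject (ModuleCat.{0} ℂ)} {W : J → CosimplicialObject (ModuleCat.{0} ℂ)}
    (a : ∀ j, W j ⟶ V) (b : ∀ j, V ⟶ W j)
    (hab : ∀ j, a j ≫ b j = 𝟙 _) (hne : ∀ j k, j ≠ k → a j ≫ b k = 0)
    (htot : ∑ j, b j ≫ a j = 𝟙 V) (q : ℕ) :
    Module.rank ℂ ((cosimplicialCohomology q).obj V) =
      ∑ j, Module.rank ℂ ((cosimplicialCohomology q).obj (W j)) := by
  refine rank_eq_sum_of_decomposition (fun j => (cosimplicialCohomology q).map (a j))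
    (fun j => (cosimplicialCohomology q).map (b j)) ?_ ?_ ?_
  · intro j
    rw [← Functor.map_comp, hab, CategoryTheory.Functor.map_id]
  · intro j k hjk
    rw [← Functor.map_comp, hne j k hjk, Functor.map_zero]
  · simp_rw [← Functor.map_comp]
    rw [← Functor.map_sum, htot, CategoryTheory.Functor.map_id]

end Additive

/-! ### The cyclic cover, its lifts and its deck transformations -/

section CyclicCohomology

variable {ι : Type} [Fintype ι] {ℓ : ℕ} (A : Arrangement ι ℓ) {m : ℕ} (hm : 0 < m)

namespace Arrangement

omit [Fintype ι] in
lemma mem_complement {x : Fin ℓ → ℂ} : x ∈ A.complement ↔ ∀ i, A.form i x ≠ 0 := by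
  simp [complement, hyperplane]

omit [Fintype ι] in
lemma continuous_form (i : ι) : Continuous (A.form i) := AffineMap.continuous_of_finiteDimensional _

/-- The defining polynomial as a nowhere vanishing function on the complement. -/
def definingMap : C(A.complement, PuncturedPlane) where
  toFun x := ⟨A.Q x, Finset.prod_ne_zero_iff.2 fun i _ => A.mem_complement.1 x.2 i⟩
  continuous_toFun := by
    refine Continuous.subtype_mk (continuous_finsetProd _ fun i _ => ?_) _
    exact (A.continuous_form i).comp continuous_subtype_val

/-- The covering projection of the cyclic cover. -/
def coverProj (m : ℕ) : C(A.cover m, A.complement) where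
  toFun e := ⟨e.1.1, e.2.1⟩
  continuous_toFun := by fun_prop

/-- The root of the defining polynomial on the cyclic cover. -/
def coverRoot (m : ℕ) : C(A.cover m, PuncturedPlane) where
  toFun e := ⟨e.1.2, e.2.2.1⟩
  continuous_toFun := by fun_prop

lemma powMap_coverRoot (e : A.cover m) :
    powMap m (A.coverRoot m e) = A.definingMap (A.coverProj m e) :=
  Subtype.ext e.2.2.2.symm

/-- The lift to the cyclic cover of a map to the complement given by a root of the defining
polynomial. -/
def coverLift {Y : Type*} [TopologicalSpace Y] (σ : C(Y, A.complement)) (s : C(Y, PuncturedPlane))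
    (h : ∀ y, powMap m (s y) = A.definingMap (σ y)) : C(Y, A.cover m) where
  toFun y := ⟨(σ y, s y), (σ y).2, (s y).2, (congrArg Subtype.val (h y)).symm⟩
  continuous_toFun := by fun_prop

include hm in
lemma exists_coverLift {Y : Type*} [TopologicalSpace Y] [ContractibleSpace Y]
    (σ : C(Y, A.complement)) : ∃ σ' : C(Y, A.cover m), (A.coverProj m).comp σ' = σ := by
  obtain ⟨s, hs⟩ := (isCoveringMap_powMap hm).exists_lift_of_contractibleSpace
    (powMap_surjective hm) (A.definingMap.comp σ)
  exact ⟨A.coverLift σ s hs, rfl⟩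

/-- The deck transformation of the cyclic cover given by a root of unity. -/
def deck (ξ : rootsOfUnity m ℂ) : C(A.cover m, A.cover m) where
  toFun e := ⟨(e.1.1, ((ξ : ℂˣ) : ℂ) * e.1.2), e.2.1, mul_ne_zero (Units.ne_zero _) e.2.2.1, by
    have : ((ξ : ℂˣ) : ℂ) ^ m = 1 := by
      rw [← Units.val_pow_eq_pow_val, (mem_rootsOfUnity m _).1 ξ.2, Units.val_one]
    rw [mul_pow, this, one_mul]
    exact e.2.2.2⟩
  continuous_toFun := by fun_prop

lemma deck_mul (ξ η : rootsOfUnity m ℂ) (e : A.cover m) :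
    A.deck ξ (A.deck η e) = A.deck (ξ * η) e :=
  Subtype.ext (Prod.ext rfl (mul_assoc _ _ _).symm)

lemma deck_one (e : A.cover m) : A.deck 1 e = e :=
  Subtype.ext (Prod.ext rfl (one_mul _))

-- The two lifts give two `m`-th roots of the same function on a connected space. Their ratio at
-- `y₀` is a root of unity, and uniqueness of lifts through `powMap` spreads this ratio over all of
-- `Y`.
include hm in
lemma exists_deck_comp_eq {Y : Type*} [TopologicalSpace Y] [PreconnectedSpace Y] [Nonempty Y]
    (σ τ : C(Y, A.cover m)) (h : (A.coverProj m).comp σ = (A.coverProj m).comp τ) :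
    ∃ ξ : rootsOfUnity m ℂ, τ = (A.deck ξ).comp σ := by
  obtain ⟨y₀⟩ := ‹Nonempty Y›
  have hroot : ∀ y, ((A.coverRoot m (σ y)) : ℂ) ^ m = (A.coverRoot m (τ y) : ℂ) ^ m := by
    intro y
    have h1 := A.powMap_coverRoot (σ y)
    have h2 := A.powMap_coverRoot (τ y)
    have h3 : A.coverProj m (σ y) = A.coverProj m (τ y) := congrArg (fun F => F y) h
    rw [h3, ← h2] at h1
    exact congrArg Subtype.val h1
  let u : ℂˣ := Units.mk0 _ (A.coverRoot m (τ y₀)).2 / Units.mk0 _ (A.coverRoot m (σ y₀)).2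
  have hu : u ^ m = 1 := by
    apply Units.ext
    simp only [u, Units.val_pow_eq_pow_val, Units.val_div_eq_div_val, Units.val_mk0, div_pow,
      hroot y₀, Units.val_one]
    exact div_self (pow_ne_zero _ (A.coverRoot m (τ y₀)).2)
  let ξ : rootsOfUnity m ℂ := ⟨u, (mem_rootsOfUnity m u).2 hu⟩
  refine ⟨ξ, ?_⟩
  have key : (fun y => A.coverRoot m (τ y)) = fun y => A.coverRoot m (A.deck ξ (σ y)) := by
    refine (isCoveringMap_powMap hm).eq_of_comp_eq (by fun_prop) (by fun_prop) ?_ y₀ ?_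
    · funext y
      apply Subtype.ext
      change (A.coverRoot m (τ y) : ℂ) ^ m = (((ξ : ℂˣ) : ℂ) * A.coverRoot m (σ y)) ^ m
      have : (((ξ : ℂˣ) : ℂ)) ^ m = 1 := by
        rw [← Units.val_pow_eq_pow_val, hu, Units.val_one]
      rw [mul_pow, this, one_mul, hroot]
    · apply Subtype.ext
      change (A.coverRoot m (τ y₀) : ℂ) = ((A.coverRoot m (τ y₀) : ℂ) / A.coverRoot m (σ y₀)) *
        A.coverRoot m (σ y₀)
      rw [div_mul_cancel₀ _ (A.coverRoot m (σ y₀)).2]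
  refine ContinuousMap.ext fun y => Subtype.ext (Prod.ext ?_ ?_)
  · exact congrArg (fun F => ((F y : A.complement) : Fin ℓ → ℂ)) h.symm
  · exact congrArg Subtype.val (congrFun key y)

end Arrangement

end CyclicCohomology

/-! ### Cochains with constant coefficients -/

section ScalarCochains

/-- The cosimplicial vector space of singular cochains with values in `ℂ`. -/
def scalarCochains (E : Type) [TopologicalSpace E] : CosimplicialObject (ModuleCat.{0} ℂ) where
  obj n := ModuleCat.of ℂ (C(Simplex n, E) → ℂ)
  map θ := ModuleCat.ofHom (LinearMap.funLeft ℂ ℂ fun σ => σ.comp (simplexMap θ))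
  -- Transport in the constant system is the identity by definition, so the functor laws can be
  -- borrowed.
  map_id n := (cochains (constantSystem E)).map_id n
  map_comp θ η := (cochains (constantSystem E)).map_comp θ η

lemma cochains_constantSystem (E : Type) [TopologicalSpace E] :
    cochains (constantSystem E) = scalarCochains E := rfl

lemma map_comp_map {X Y Z : Type} [TopologicalSpace X] [TopologicalSpace Y] [TopologicalSpace Z]
    (g : C(Y, Z)) (f : C(X, Y)) {a b : FundamentalGroupoid X} (γ : a ⟶ b) :
    (FundamentalGroupoid.map (g.comp f)).map γ =
      (FundamentalGroupoid.map g).map ((FundamentalGroupoid.map f).map γ) := by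
  induction γ using Quotient.ind
  rfl

end ScalarCochains

/-! ### Eigenspace decomposition of the cochains of the cover -/

section Decomposition

variable {ι : Type} [Fintype ι] {ℓ : ℕ} (A : Arrangement ι ℓ) {m : ℕ} (hm : 0 < m)
  (x₀ : A.complement)

namespace Arrangement

/-- The character of the fundamental group of the complement describing the monodromy of the `m`-th
roots of the defining polynomial. -/
abbrev rootChar : FundamentalGroup A.complement x₀ →* ℂˣ := rootCharacter A.definingMap hm x₀

/-- The rank one local system given by a power of the monodromy character of the `m`-th roots of the
defining polynomial. -/
abbrev powSystem (j : ℕ) : LocalSystem A.complement := inducedSystem (A.rootChar hm x₀ ^ j)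

/-- The factor comparing the continuation along a path of the chosen root at the base point with a
given number. -/
def rootRatio {x : A.complement} (z : PuncturedPlane)
    (p : FundamentalGroupoid.mk x₀ ⟶ FundamentalGroupoid.mk x) : ℂˣ :=
  rootTransport A.definingMap hm p *
    Units.mk0 _ (chosenRoot hm (A.definingMap x₀)).1.ne_zero / Units.mk0 _ z.ne_zero

variable {A x₀} in
lemma rootRatio_comp {x : A.complement} (z : PuncturedPlane)
    (g : FundamentalGroupoid.mk x₀ ⟶ FundamentalGroupoid.mk x₀)
    (p : FundamentalGroupoid.mk x₀ ⟶ FundamentalGroupoid.mk x) :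
    A.rootRatio hm x₀ z (g ≫ p) = A.rootChar hm x₀ g * A.rootRatio hm x₀ z p := by
  rw [rootRatio, rootTransport_comp, rootRatio, mul_assoc, mul_div_assoc, mul_div_assoc]
  rfl

-- Replacing `p'` by `g ≫ p'` multiplies `s` by `χ(g)^(-j)` and the `j`-th power of the ratio by
-- `χ(g)^j`. The product therefore depends only on the end point and on the root `z`.
variable {A x₀} in
lemma mul_rootRatio_eq (j : ℕ) {x : A.complement} (z : PuncturedPlane)
    (s : inducedStalk (A.rootChar hm x₀ ^ j) (.mk x))
    (p p' : FundamentalGroupoid.mk x₀ ⟶ FundamentalGroupoid.mk x) :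
    s.1 p * (A.rootRatio hm x₀ z p ^ j : ℂˣ) = s.1 p' * (A.rootRatio hm x₀ z p' ^ j : ℂˣ) := by
  obtain ⟨g, rfl⟩ : ∃ g : FundamentalGroupoid.mk x₀ ⟶ FundamentalGroupoid.mk x₀, p = g ≫ p' :=
    ⟨p ≫ Groupoid.inv p', by simp⟩
  rw [s.2 g p', rootRatio_comp, mul_pow, MonoidHom.pow_apply, Units.val_mul]
  have h : ((((A.rootChar hm x₀) g ^ j)⁻¹ : ℂˣ) : ℂ) * ((A.rootChar hm x₀) g ^ j : ℂˣ) = 1 :=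
    Units.inv_mul _
  linear_combination s.1 p' * ((A.rootRatio hm x₀ z p' ^ j : ℂˣ) : ℂ) * h

variable [PathConnectedSpace A.complement]

/-- A path class from the base point. -/
def basePath (x : A.complement) : FundamentalGroupoid.mk x₀ ⟶ FundamentalGroupoid.mk x :=
  FundamentalGroupoid.fromPath (Path.Homotopic.Quotient.mk (PathConnectedSpace.somePath x₀ x))

/-- A choice of root of the defining polynomial at a point identifies the stalk of the rank one
local system with `ℂ`. -/
def evalAt (j : ℕ) (x : A.complement) (z : PuncturedPlane) :
    inducedStalk (A.rootChar hm x₀ ^ j) (.mk x) →ₗ[ℂ] ℂ where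
  toFun s := s.1 (A.basePath x₀ x) * (A.rootRatio hm x₀ z (A.basePath x₀ x) ^ j : ℂˣ)
  map_add' _ _ := add_mul _ _ _
  map_smul' _ _ := mul_assoc _ _ _

lemma evalAt_apply (j : ℕ) {x : A.complement} (z : PuncturedPlane)
    (s : inducedStalk (A.rootChar hm x₀ ^ j) (.mk x))
    (p : FundamentalGroupoid.mk x₀ ⟶ FundamentalGroupoid.mk x) :
    A.evalAt hm x₀ j x z s = s.1 p * (A.rootRatio hm x₀ z p ^ j : ℂˣ) :=
  mul_rootRatio_eq hm j z s _ p

/-- The inverse of `evalAt`. -/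
def evalAtInv (j : ℕ) (x : A.complement) (z : PuncturedPlane) (c : ℂ) :
    inducedStalk (A.rootChar hm x₀ ^ j) (.mk x) :=
  ⟨fun p => c * ((A.rootRatio hm x₀ z p ^ j)⁻¹ : ℂˣ), fun g p => by
    change c * ((A.rootRatio hm x₀ z (g ≫ p) ^ j)⁻¹ : ℂˣ) = _
    rw [rootRatio_comp, mul_pow, mul_inv, Units.val_mul, MonoidHom.pow_apply]
    ring⟩

lemma evalAt_evalAtInv (j : ℕ) (x : A.complement) (z : PuncturedPlane) (c : ℂ) :
    A.evalAt hm x₀ j x z (A.evalAtInv hm x₀ j x z c) = c := by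
  change c * ((A.rootRatio hm x₀ z (A.basePath x₀ x) ^ j)⁻¹ : ℂˣ) *
    (A.rootRatio hm x₀ z (A.basePath x₀ x) ^ j : ℂˣ) = c
  rw [mul_assoc, Units.inv_mul, mul_one]

lemma evalAt_injective (j : ℕ) (x : A.complement) (z : PuncturedPlane) :
    Function.Injective (A.evalAt hm x₀ j x z) := by
  intro s t h
  refine Subtype.ext (funext fun p => ?_)
  rw [evalAt_apply _ _ _ _ _ _ p, evalAt_apply _ _ _ _ _ _ p] at h
  exact mul_right_cancel₀ (Units.ne_zero _) h

/-- When the root is continued along with the section, the two changes cancel. Over the cover, where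
a root is part of the point, the pulled back local system is thus trivialised. -/
lemma evalAt_transport (j : ℕ) {x y : A.complement} {z w : PuncturedPlane}
    (γ : FundamentalGroupoid.mk x ⟶ FundamentalGroupoid.mk y)
    (hγ : (rootTransport A.definingMap hm γ : ℂ) * (z : ℂ) = w)
    (s : inducedStalk (A.rootChar hm x₀ ^ j) (.mk x)) :
    A.evalAt hm x₀ j y w (inducedTransport (A.rootChar hm x₀ ^ j) γ s) =
      A.evalAt hm x₀ j x z s := by
  let p := A.basePath x₀ x
  rw [evalAt_apply _ _ _ _ _ _ (p ≫ γ), evalAt_apply _ _ _ _ _ _ p]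
  have h1 : (inducedTransport (A.rootChar hm x₀ ^ j) γ s).1 (p ≫ γ) = s.1 p := by
    change s.1 ((p ≫ γ) ≫ Groupoid.inv γ) = _
    simp
  have h2 : A.rootRatio hm x₀ w (p ≫ γ) = A.rootRatio hm x₀ z p := by
    apply Units.ext
    simp only [rootRatio, rootTransport_comp, Units.val_div_eq_div_val, Units.val_mul,
      Units.val_mk0, ← hγ]
    have := z.ne_zero
    have := (rootTransport A.definingMap hm γ).ne_zero
    field_simp
  rw [h1, h2]

/-- For `u` a root of unity this is the effect of a deck transformation: cochains pulled back from
the `j`-th system have weight `-j`. -/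
lemma evalAt_mul (j : ℕ) (x : A.complement) {z w : PuncturedPlane} (u : ℂˣ)
    (hu : (w : ℂ) = u * z) (s : inducedStalk (A.rootChar hm x₀ ^ j) (.mk x)) :
    A.evalAt hm x₀ j x w s = ((u ^ j)⁻¹ : ℂˣ) * A.evalAt hm x₀ j x z s := by
  let p := A.basePath x₀ x
  rw [evalAt_apply _ _ _ _ _ _ p, evalAt_apply _ _ _ _ _ _ p]
  have h : A.rootRatio hm x₀ w p = u⁻¹ * A.rootRatio hm x₀ z p := by
    apply Units.ext
    simp only [rootRatio, Units.val_div_eq_div_val, Units.val_mul, Units.val_mk0,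
      Units.val_inv_eq_inv_val, hu]
    have := z.ne_zero
    have := u.ne_zero
    field_simp
  rw [h, mul_pow, Units.val_mul, inv_pow]
  ring

/-- Pullback of cochains to the cyclic cover. -/
def pullCochain (j : ℕ) (n : SimplexCategory) :
    Cochain (A.powSystem hm x₀ j) n →ₗ[ℂ] (C(Simplex n, A.cover m) → ℂ) where
  toFun c σ := A.evalAt hm x₀ j _ (A.coverRoot m (σ (vertexZero n))) (c ((A.coverProj m).comp σ))
  map_add' _ _ := funext fun _ => map_add (A.evalAt hm x₀ j _ _) _ _
  map_smul' _ _ := funext fun _ => map_smul (A.evalAt hm x₀ j _ _) _ _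

lemma pullCochain_cochainMap (j : ℕ) {k n : SimplexCategory} (θ : k ⟶ n)
    (c : Cochain (A.powSystem hm x₀ j) k) (σ : C(Simplex n, A.cover m)) :
    A.pullCochain hm x₀ j n (cochainMap _ θ c) σ =
      A.pullCochain hm x₀ j k c (σ.comp (simplexMap θ)) := by
  refine A.evalAt_transport hm x₀ j ((FundamentalGroupoid.map ((A.coverProj m).comp σ)).map
    (simplexPath (simplexMap θ (vertexZero k)) (vertexZero n))) ?_
    (c (((A.coverProj m).comp σ).comp (simplexMap θ)))
  rw [map_comp_map]
  exact rootTransport_map A.definingMap hm (A.coverProj m) (A.coverRoot m) A.powMap_coverRoot _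

/-- Every simplex of the complement lifts, so no value of a cochain is lost. -/
lemma pullCochain_injective (j : ℕ) (n : SimplexCategory) :
    Function.Injective (A.pullCochain hm x₀ j n) := by
  intro c d h
  funext σ
  obtain ⟨σ', rfl⟩ := A.exists_coverLift hm σ
  exact A.evalAt_injective hm x₀ j _ _ (congrFun h σ')

end Arrangement

instance [NeZero m] : Fintype (rootsOfUnity m ℂ) := Fintype.ofFinite _

/-- Averaging over the deck group of the cyclic cover, weighted by a character. -/
def averageCochain (m : ℕ) [NeZero m] (j : ℕ) (n : SimplexCategory) :
    (C(Simplex n, A.cover m) → ℂ) →ₗ[ℂ] (C(Simplex n, A.cover m) → ℂ) where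
  toFun c σ := (m : ℂ)⁻¹ * ∑ ξ : rootsOfUnity m ℂ, ((ξ : ℂˣ) : ℂ) ^ j * c ((A.deck ξ).comp σ)
  map_add' c d := funext fun σ => by
    simp only [Pi.add_apply, mul_add, Finset.sum_add_distrib]
  map_smul' a c := funext fun σ => by
    simp only [Pi.smul_apply, smul_eq_mul, RingHom.id_apply, Finset.mul_sum]
    exact Finset.sum_congr rfl fun _ _ => by ring

/-- Orthogonality of characters of `μ_m`. For `j ≠ k` below `m` the character `ξ ↦ ξ^(j-k)` is
nontrivial, as a primitive root shows. -/
lemma sum_rootsOfUnity_pow_mul_inv_pow [NeZero m] {j k : ℕ} (hj : j < m) (hk : k < m) :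
    ∑ ξ : rootsOfUnity m ℂ, ((ξ : ℂˣ) : ℂ) ^ j * (((ξ : ℂˣ) ^ k)⁻¹ : ℂˣ) =
      if j = k then (m : ℂ) else 0 := by
  split_ifs with h
  · subst h
    have : ∀ ξ : rootsOfUnity m ℂ, ((ξ : ℂˣ) : ℂ) ^ j * (((ξ : ℂˣ) ^ j)⁻¹ : ℂˣ) = 1 := by
      intro ξ
      rw [← Units.val_pow_eq_pow_val, Units.mul_inv]
    rw [Finset.sum_congr rfl fun ξ _ => this ξ, Finset.sum_const, Finset.card_univ,
      ← Nat.card_eq_fintype_card, Complex.card_rootsOfUnity, nsmul_eq_mul, mul_one]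
  · let φ : rootsOfUnity m ℂ →* ℂˣ :=
      (Subgroup.subtype _) ^ j * ((Subgroup.subtype _) ^ k)⁻¹
    have hφ : (Units.coeHom ℂ).comp φ ≠ 1 := by
      intro h1
      obtain ⟨ζ, hζ⟩ : ∃ ζ : ℂ, IsPrimitiveRoot ζ m :=
        ⟨_, Complex.isPrimitiveRoot_exp m (NeZero.ne m)⟩
      have hζ' := hζ.isUnit_unit (NeZero.ne m)
      have := DFunLike.congr_fun h1 ⟨_, (mem_rootsOfUnity m _).2 hζ'.pow_eq_one⟩
      have h2 : (hζ.isUnit (NeZero.ne m)).unit ^ j *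
          ((hζ.isUnit (NeZero.ne m)).unit ^ k)⁻¹ = 1 := Units.ext this
      exact h (hζ'.pow_inj hj hk (mul_inv_eq_one.1 h2))
    rw [← sum_hom_units_eq_zero _ hφ]
    exact Finset.sum_congr rfl fun ξ _ => by simp [φ]

lemma averageCochain_deck [NeZero m] (j : ℕ) (n : SimplexCategory)
    (c : C(Simplex n, A.cover m) → ℂ) (ξ : rootsOfUnity m ℂ) (σ : C(Simplex n, A.cover m)) :
    averageCochain A m j n c ((A.deck ξ).comp σ) =
      (((ξ : ℂˣ) ^ j)⁻¹ : ℂˣ) * averageCochain A m j n c σ := by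
  change (m : ℂ)⁻¹ * ∑ η : rootsOfUnity m ℂ, ((η : ℂˣ) : ℂ) ^ j *
    c ((A.deck η).comp ((A.deck ξ).comp σ)) = (((ξ : ℂˣ) ^ j)⁻¹ : ℂˣ) * ((m : ℂ)⁻¹ *
      ∑ η : rootsOfUnity m ℂ, ((η : ℂˣ) : ℂ) ^ j * c ((A.deck η).comp σ))
  -- The substitution `η ↦ η ξ` turns the average at the translated simplex into the average at `σ`.
  rw [← Equiv.sum_comp (Equiv.mulRight ξ) fun η : rootsOfUnity m ℂ => ((η : ℂˣ) : ℂ) ^ j *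
    c ((A.deck η).comp σ), mul_left_comm]
  congr 1
  rw [Finset.mul_sum]
  refine Finset.sum_congr rfl fun η _ => ?_
  have h : (A.deck η).comp ((A.deck ξ).comp σ) = (A.deck (η * ξ)).comp σ :=
    ContinuousMap.ext fun t => A.deck_mul _ _ _
  rw [h, Equiv.coe_mulRight, Subgroup.coe_mul, Units.val_mul, mul_pow, ← mul_assoc]
  congr 1
  have h : ((((ξ : ℂˣ) ^ j)⁻¹ : ℂˣ) : ℂ) * ((ξ : ℂˣ) : ℂ) ^ j = 1 := by
    rw [← Units.val_pow_eq_pow_val, Units.inv_mul]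
  linear_combination -((η : ℂˣ) : ℂ) ^ j * h

/-- After exchanging the sums, the geometric sum `∑ ξ^j` vanishes unless `ξ = 1`, where it is `m`.
-/
lemma sum_averageCochain [NeZero m] (n : SimplexCategory) (c : C(Simplex n, A.cover m) → ℂ) :
    ∑ j : Fin m, averageCochain A m j n c = c := by
  funext σ
  rw [Finset.sum_apply]
  change ∑ j : Fin m, (m : ℂ)⁻¹ * ∑ ξ : rootsOfUnity m ℂ, ((ξ : ℂˣ) : ℂ) ^ (j : ℕ) *
    c ((A.deck ξ).comp σ) = c σ
  rw [← Finset.mul_sum, Finset.sum_comm, Finset.sum_eq_single 1]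
  · have h : (A.deck 1).comp σ = σ := ContinuousMap.ext fun t => A.deck_one _
    rw [h]
    simp [NeZero.ne m]
  · intro ξ _ hξ
    rw [← Finset.sum_mul, Fin.sum_univ_eq_sum_range fun j => ((ξ : ℂˣ) : ℂ) ^ j]
    have h1 : ((ξ : ℂˣ) : ℂ) ≠ 1 := fun h => hξ (Subtype.ext (Units.ext h))
    have h2 : ((ξ : ℂˣ) : ℂ) ^ m = 1 := by
      rw [← Units.val_pow_eq_pow_val, (mem_rootsOfUnity m _).1 ξ.2, Units.val_one]
    rw [geom_sum_eq h1, h2, sub_self, zero_div, zero_mul]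
  · simp

namespace Arrangement

variable [PathConnectedSpace A.complement]

lemma averageCochain_pullCochain [NeZero m] {j k : ℕ} (hj : j < m) (hk : k < m)
    (n : SimplexCategory) (c : Cochain (A.powSystem hm x₀ k) n) :
    averageCochain A m j n (A.pullCochain hm x₀ k n c) =
      if j = k then A.pullCochain hm x₀ k n c else 0 := by
  funext σ
  have h : averageCochain A m j n (A.pullCochain hm x₀ k n c) σ =
      (m : ℂ)⁻¹ * ((if j = k then (m : ℂ) else 0) * A.pullCochain hm x₀ k n c σ) := by
    rw [← sum_rootsOfUnity_pow_mul_inv_pow hj hk, Finset.sum_mul]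
    change (m : ℂ)⁻¹ * ∑ ξ : rootsOfUnity m ℂ, ((ξ : ℂˣ) : ℂ) ^ j *
      A.evalAt hm x₀ k (A.coverProj m (σ (vertexZero n)))
        (A.coverRoot m (A.deck ξ (σ (vertexZero n)))) (c ((A.coverProj m).comp σ)) = _
    congr 1
    refine Finset.sum_congr rfl fun ξ _ => ?_
    rw [mul_assoc]
    exact congrArg _ (A.evalAt_mul hm x₀ k _ (z := A.coverRoot m (σ (vertexZero n))) (ξ : ℂˣ)
      rfl (c ((A.coverProj m).comp σ)))
  rw [h]
  split_ifs
  · rw [inv_mul_cancel_left₀ (Nat.cast_ne_zero.2 hm.ne')]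
  · rw [zero_mul, mul_zero]
    rfl

/-- Descent of cochains of weight `-j`. The stalk value is prescribed through one lift `τ` of `σ`;
any other lift differs by a deck transformation, under which `averageCochain_deck` and `evalAt_mul`
give the same factor. -/
lemma averageCochain_mem_range [NeZero m] (j : ℕ) (n : SimplexCategory)
    (c : C(Simplex n, A.cover m) → ℂ) :
    averageCochain A m j n c ∈ LinearMap.range (A.pullCochain hm x₀ j n) := by
  have h : ∀ σ : C(Simplex n, A.complement),
      ∃ s : inducedStalk (A.rootChar hm x₀ ^ j) (.mk (σ (vertexZero n))),
        ∀ σ' : C(Simplex n, A.cover m), (A.coverProj m).comp σ' = σ →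
          A.evalAt hm x₀ j _ (A.coverRoot m (σ' (vertexZero n))) s =
            averageCochain A m j n c σ' := by
    intro σ
    obtain ⟨τ, hτ⟩ := A.exists_coverLift hm σ
    refine ⟨A.evalAtInv hm x₀ j _ (A.coverRoot m (τ (vertexZero n)))
      (averageCochain A m j n c τ), fun σ' hσ' => ?_⟩
    obtain ⟨ξ, rfl⟩ := A.exists_deck_comp_eq hm τ σ' (hτ.trans hσ'.symm)
    rw [averageCochain_deck, A.evalAt_mul hm x₀ j _
      (z := A.coverRoot m (τ (vertexZero n))) (ξ : ℂˣ) rfl, evalAt_evalAtInv]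
  choose s hs using h
  exact ⟨s, funext fun σ' => hs _ σ' rfl⟩

/-- A left inverse of the pullback of cochains: averaging over the deck group, followed by
descent. -/
def pushCochain [NeZero m] (j : ℕ) (n : SimplexCategory) :
    (C(Simplex n, A.cover m) → ℂ) →ₗ[ℂ] Cochain (A.powSystem hm x₀ j) n :=
  (LinearEquiv.ofInjective _ (A.pullCochain_injective hm x₀ j n)).symm.toLinearMap ∘ₗ
    (averageCochain A m j n).codRestrict _ (A.averageCochain_mem_range hm x₀ j n)

lemma pullCochain_pushCochain [NeZero m] (j : ℕ) (n : SimplexCategory)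
    (c : C(Simplex n, A.cover m) → ℂ) :
    A.pullCochain hm x₀ j n (A.pushCochain hm x₀ j n c) = averageCochain A m j n c :=
  congrArg Subtype.val (LinearEquiv.apply_symm_apply
    (LinearEquiv.ofInjective _ (A.pullCochain_injective hm x₀ j n))
      ⟨averageCochain A m j n c, A.averageCochain_mem_range hm x₀ j n c⟩)

lemma pushCochain_pullCochain [NeZero m] {j k : ℕ} (hj : j < m) (hk : k < m) (n : SimplexCategory)
    (c : Cochain (A.powSystem hm x₀ j) n) (hjk : j ≠ k) :
    A.pushCochain hm x₀ k n (A.pullCochain hm x₀ j n c) = 0 := by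
  apply A.pullCochain_injective hm x₀ k n
  rw [pullCochain_pushCochain, averageCochain_pullCochain A hm x₀ hk hj, if_neg hjk.symm, map_zero]

lemma pushCochain_pullCochain_self [NeZero m] {j : ℕ} (hj : j < m) (n : SimplexCategory)
    (c : Cochain (A.powSystem hm x₀ j) n) :
    A.pushCochain hm x₀ j n (A.pullCochain hm x₀ j n c) = c := by
  apply A.pullCochain_injective hm x₀ j n
  rw [pullCochain_pushCochain, averageCochain_pullCochain A hm x₀ hj hj, if_pos rfl]

lemma pushCochain_comp_simplexMap [NeZero m] (j : ℕ) {k n : SimplexCategory} (θ : k ⟶ n)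
    (c : C(Simplex k, A.cover m) → ℂ) :
    A.pushCochain hm x₀ j n (fun σ => c (σ.comp (simplexMap θ))) =
      cochainMap _ θ (A.pushCochain hm x₀ j k c) := by
  apply A.pullCochain_injective hm x₀ j n
  funext σ
  rw [pullCochain_cochainMap, pullCochain_pushCochain, pullCochain_pushCochain]
  rfl

/-- Pullback of cochains as a map of cosimplicial vector spaces. -/
def pullMap (j : ℕ) : cochains (A.powSystem hm x₀ j) ⟶ scalarCochains (A.cover m) where
  app n := ModuleCat.ofHom (A.pullCochain hm x₀ j n)
  naturality k n θ := by
    ext1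
    refine LinearMap.ext fun c => funext fun σ => ?_
    exact A.pullCochain_cochainMap hm x₀ j θ c σ

/-- The left inverse of the pullback of cochains as a map of cosimplicial vector spaces. -/
def pushMap [NeZero m] (j : ℕ) :
    scalarCochains (A.cover m) ⟶ cochains (A.powSystem hm x₀ j) where
  app n := ModuleCat.ofHom (A.pushCochain hm x₀ j n)
  naturality k n θ := by
    ext1
    exact LinearMap.ext fun c => A.pushCochain_comp_simplexMap hm x₀ j θ c

lemma pullMap_pushMap [NeZero m] {j k : ℕ} (hj : j < m) (hk : k < m) (hjk : j ≠ k) :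
    A.pullMap hm x₀ j ≫ A.pushMap hm x₀ k = 0 := by
  refine NatTrans.ext (funext fun n => ?_)
  ext1
  exact LinearMap.ext fun c => A.pushCochain_pullCochain hm x₀ hj hk n c hjk

lemma pullMap_pushMap_self [NeZero m] {j : ℕ} (hj : j < m) :
    A.pullMap hm x₀ j ≫ A.pushMap hm x₀ j = 𝟙 _ := by
  refine NatTrans.ext (funext fun n => ?_)
  ext1
  exact LinearMap.ext fun c => A.pushCochain_pullCochain_self hm x₀ hj n c

lemma sum_pushMap_pullMap [NeZero m] :
    ∑ j : Fin m, A.pushMap hm x₀ j ≫ A.pullMap hm x₀ j = 𝟙 _ := by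
  refine NatTrans.ext (funext fun n => ?_)
  ext1
  refine LinearMap.ext fun c => ?_
  have h : (∑ j : Fin m, A.pushMap hm x₀ j ≫ A.pullMap hm x₀ j).app n =
      ∑ j : Fin m, (A.pushMap hm x₀ j ≫ A.pullMap hm x₀ j).app n :=
    map_sum (AddMonoidHom.mk' (fun η : scalarCochains (A.cover m) ⟶ scalarCochains (A.cover m) =>
      η.app n) fun _ _ => rfl) _ _
  rw [h, ModuleCat.hom_sum, LinearMap.sum_apply]
  refine Eq.trans (Finset.sum_congr rfl fun j _ => ?_) (sum_averageCochain A n c)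
  exact A.pullCochain_pushCochain hm x₀ j n c

/-- The cohomology of the cyclic cover is the direct sum of the cohomologies of the complement with
coefficients in the powers of the monodromy local system. -/
theorem betti_cover_eq_sum (q : ℕ) :
    betti (A.cover m) q = ∑ j : Fin m, bettiLocal (A.powSystem hm x₀ j) q := by
  have : NeZero m := ⟨hm.ne'⟩
  rw [betti, bettiLocal_eq, cochains_constantSystem]
  exact rank_cohomology_eq_sum (fun j : Fin m => A.pullMap hm x₀ j)
    (fun j : Fin m => A.pushMap hm x₀ j) (fun j => A.pullMap_pushMap_self hm x₀ j.2)
    (fun j k hjk => A.pullMap_pushMap hm x₀ j.2 k.2 fun h => hjk (Fin.ext h))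
    (A.sum_pushMap_pullMap hm x₀) q

end Arrangement

end Decomposition

/-! ### Field automorphisms of `ℂ` permuting roots of unity -/

section FieldAutomorphism

-- Transcendence bases of `ℂ` over countable subfields both have the cardinality of `ℂ`. A bijection
-- between them extends `s` to the polynomial rings they generate, and `ℂ` is an algebraic closure
-- of each of these.
open Cardinal in
lemma exists_ringEquiv_of_ringEquiv_of_countable (K K' : Subfield ℂ) (s : K ≃+* K')
    (hK : #K ≤ ℵ₀) (hK' : #K' ≤ ℵ₀) :
    ∃ σ : ℂ ≃+* ℂ, ∀ x : K, σ x = s x := by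
  obtain ⟨v, hv⟩ := exists_isTranscendenceBasis K ℂ
  obtain ⟨w, hw⟩ := exists_isTranscendenceBasis K' ℂ
  have hC : ℵ₀ < #ℂ := by
    rw [Cardinal.mk_complex]
    exact Cardinal.aleph0_lt_continuum
  have h1 := IsAlgClosed.cardinal_eq_cardinal_transcendence_basis_of_aleph0_lt' _ hv hK hC
  have h2 := IsAlgClosed.cardinal_eq_cardinal_transcendence_basis_of_aleph0_lt' _ hw hK' hC
  obtain ⟨e⟩ := Cardinal.eq.1 (h1.symm.trans h2)
  let := IsAlgClosed.isAlgClosure_of_transcendence_basis _ hv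
  let := IsAlgClosed.isAlgClosure_of_transcendence_basis _ hw
  let E : MvPolynomial v K ≃+* MvPolynomial w K' :=
    (MvPolynomial.renameEquiv K e).toRingEquiv.trans (MvPolynomial.mapEquiv w s)
  let F : Algebra.adjoin K (Set.range ((↑) : v → ℂ)) ≃+*
      Algebra.adjoin K' (Set.range ((↑) : w → ℂ)) :=
    (hv.1.aevalEquiv.symm.toRingEquiv.trans E).trans hw.1.aevalEquiv.toRingEquiv
  refine ⟨IsAlgClosure.equivOfEquiv ℂ ℂ F, fun x => ?_⟩
  have h3 := IsAlgClosure.equivOfEquiv_algebraMap ℂ ℂ F (algebraMap K _ x)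
  have h4 : F (algebraMap K _ x) = algebraMap K' _ (s x) := by
    have h5 : hv.1.aevalEquiv.symm (algebraMap K _ x) = MvPolynomial.C x :=
      AlgEquiv.commutes _ _
    change hw.1.aevalEquiv (E (hv.1.aevalEquiv.symm (algebraMap K _ x))) = _
    rw [h5]
    have h6 : E (MvPolynomial.C x) = MvPolynomial.C (s x) := by
      simp [E]
    rw [h6]
    exact AlgEquiv.commutes _ _
  rw [h4] at h3
  exact h3

/-- Both numbers have the `k`-th cyclotomic polynomial as minimal polynomial, so `ℚ(ζ)` and `ℚ(ζ')`
are isomorphic countable fields. -/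
lemma exists_ringEquiv_of_isPrimitiveRoot {k : ℕ} (hk : 0 < k) {ζ ζ' : ℂ}
    (hζ : IsPrimitiveRoot ζ k) (hζ' : IsPrimitiveRoot ζ' k) : ∃ σ : ℂ ≃+* ℂ, σ ζ = ζ' := by
  have hint : IsAlgebraic ℚ ζ := (hζ.isIntegral hk).tower_top.isAlgebraic
  have hint' : IsAlgebraic ℚ ζ' := (hζ'.isIntegral hk).tower_top.isAlgebraic
  have h : minpoly ℚ ζ = minpoly ℚ ζ' := by
    rw [← Polynomial.cyclotomic_eq_minpoly_rat hζ hk, ← Polynomial.cyclotomic_eq_minpoly_rat hζ' hk]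
  let s := minpoly.algEquiv hint h
  have hcard : ∀ {x : ℂ}, IsAlgebraic ℚ x → Cardinal.mk (IntermediateField.adjoin ℚ {x}) ≤
      Cardinal.aleph0 := by
    intro x hx
    have : Algebra.IsAlgebraic ℚ (IntermediateField.adjoin ℚ {x}) :=
      IntermediateField.isAlgebraic_adjoin_simple hx.isIntegral
    refine (Algebra.IsAlgebraic.cardinalMk_le_max ℚ _).trans ?_
    simp
  obtain ⟨σ, hσ⟩ := exists_ringEquiv_of_ringEquiv_of_countable
    (IntermediateField.adjoin ℚ {ζ}).toSubfield (IntermediateField.adjoin ℚ {ζ'}).toSubfield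
    s.toRingEquiv (hcard hint) (hcard hint')
  refine ⟨σ, (hσ (IntermediateField.AdjoinSimple.gen ℚ ζ)).trans ?_⟩
  exact congrArg Subtype.val (minpoly.algEquiv_apply hint h)

end FieldAutomorphism

/-! ### Betti numbers are invariant under Galois conjugation of the character -/

section Semilinear

lemma rank_homology_eq_of_semilinearEquiv (σ : ℂ ≃+* ℂ) {S S' : ShortComplex (ModuleCat.{0} ℂ)}
    (e : S.X₂ ≃+ S'.X₂) (he : ∀ (a : ℂ) x, e (a • x) = σ a • e x)
    (hg : ∀ x, S.g.hom x = 0 ↔ S'.g.hom (e x) = 0)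
    (hf : ∀ x, (∃ y, S.f.hom y = x) ↔ ∃ y, S'.f.hom y = e x) :
    Module.rank ℂ S.homology = Module.rank ℂ S'.homology := by
  rw [S.moduleCatHomologyIso.toLinearEquiv.rank_eq, S'.moduleCatHomologyIso.toLinearEquiv.rank_eq]
  let φ : LinearMap.ker S.g.hom →ₛₗ[(σ : ℂ →+* ℂ)] LinearMap.ker S'.g.hom :=
    { toFun := fun x => ⟨e x, (hg x).1 x.2⟩
      map_add' := fun x y => Subtype.ext (map_add e _ _)
      map_smul' := fun a x => Subtype.ext (he a x) }
  have hmem : ∀ x, x ∈ LinearMap.range S.moduleCatToCycles ↔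
      φ x ∈ LinearMap.range S'.moduleCatToCycles := by
    intro x
    have h1 : ∀ (T : ShortComplex (ModuleCat.{0} ℂ)) (z : LinearMap.ker T.g.hom),
        z ∈ LinearMap.range T.moduleCatToCycles ↔ ∃ y, T.f.hom y = z := fun T z =>
      exists_congr fun y => Subtype.ext_iff
    rw [h1, h1]
    exact hf x
  let ψ := Submodule.mapQ (LinearMap.range S.moduleCatToCycles)
    (LinearMap.range S'.moduleCatToCycles) φ fun x hx => (hmem x).1 hx
  have hψ : Function.Bijective ψ := by
    constructor
    · refine (injective_iff_map_eq_zero ψ).2 fun z hz => ?_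
      obtain ⟨x, rfl⟩ := Submodule.mkQ_surjective _ z
      rw [Submodule.mkQ_apply, Submodule.mapQ_apply, Submodule.Quotient.mk_eq_zero] at hz
      rw [Submodule.mkQ_apply, Submodule.Quotient.mk_eq_zero]
      exact (hmem x).2 hz
    · intro z
      obtain ⟨x, rfl⟩ := Submodule.mkQ_surjective _ z
      obtain ⟨y, hy⟩ := e.surjective x
      have hy' : S.g.hom y = 0 := by
        rw [hg, hy]
        exact x.2
      refine ⟨Submodule.mkQ _ ⟨y, hy'⟩, ?_⟩
      rw [Submodule.mkQ_apply, Submodule.mapQ_apply]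
      exact congrArg _ (Subtype.ext hy)
  exact rank_eq_of_equiv_equiv σ (AddEquiv.ofBijective ψ hψ) σ.bijective fun a z => map_smulₛₗ ψ a z

lemma hom_sum_zsmul_apply {V W : ModuleCat.{0} ℂ} {J : Type} [Fintype J] (a : J → ℤ) (f : J → (V ⟶ W))
    (y : V) : (∑ l, a l • f l).hom y = ∑ l, a l • (f l).hom y := by
  rw [ModuleCat.hom_sum]
  exact LinearMap.sum_apply _ _ _

/-- The coefficients of the differential are the integers `±1`, so an additive map that commutes
with the cofaces commutes with the differential, although it is only semilinear. -/
lemma rank_cohomology_eq_of_semilinearEquiv (σ : ℂ ≃+* ℂ)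
    {V V' : CosimplicialObject (ModuleCat.{0} ℂ)} (e : ∀ n, V.obj n ≃+ V'.obj n)
    (he : ∀ n (a : ℂ) x, e n (a • x) = σ a • e n x)
    (hmap : ∀ {k n : SimplexCategory} (θ : k ⟶ n) x, e n ((V.map θ).hom x) = (V'.map θ).hom (e k x))
    (q : ℕ) :
    Module.rank ℂ ((cosimplicialCohomology q).obj V) =
      Module.rank ℂ ((cosimplicialCohomology q).obj V') := by
  let C := AlgebraicTopology.AlternatingCofaceMapComplex.obj V
  let C' := AlgebraicTopology.AlternatingCofaceMapComplex.obj V'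
  have hd : ∀ i j (x : C.X i), e (.mk j) ((C.d i j).hom x) = (C'.d i j).hom (e (.mk i) x) := by
    intro i j x
    by_cases hij : i + 1 = j
    · subst hij
      have h1 : ∀ W : CosimplicialObject (ModuleCat.{0} ℂ),
          (AlgebraicTopology.AlternatingCofaceMapComplex.obj W).d i (i + 1) =
            ∑ l : Fin (i + 2), (-1 : ℤ) ^ (l : ℕ) • W.δ l := fun W =>
        CochainComplex.of_d (fun n => W.obj (.mk n))
          (AlgebraicTopology.AlternatingCofaceMapComplex.objD W) i
      have h2 : ∀ (W : CosimplicialObject (ModuleCat.{0} ℂ)) (y : W.obj (.mk i)),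
          ((AlgebraicTopology.AlternatingCofaceMapComplex.obj W).d i (i + 1)).hom y =
            ∑ l : Fin (i + 2), (-1 : ℤ) ^ (l : ℕ) • (W.map (SimplexCategory.δ l)).hom y := by
        intro W y
        rw [h1]
        exact hom_sum_zsmul_apply _ (fun l : Fin (i + 2) => W.δ l) y
      refine (congrArg _ (h2 V x)).trans (Eq.trans ?_ (h2 V' _).symm)
      refine (map_sum (e (.mk (i + 1))) _ _).trans (Finset.sum_congr rfl fun l _ => ?_)
      exact (map_zsmul (e (.mk (i + 1))) _ _).trans (congrArg _ (hmap _ _))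
    · have h1 : C.d i j = 0 := C.shape i j hij
      have h2 : C'.d i j = 0 := C'.shape i j hij
      rw [h1, h2]
      exact map_zero (e (.mk j))
  refine rank_homology_eq_of_semilinearEquiv σ (S := C.sc q) (S' := C'.sc q) (e (.mk q))
    (he (.mk q)) (fun x => ?_) (fun x => ?_)
  · change (C.d q _).hom x = 0 ↔ (C'.d q _).hom (e (.mk q) x) = 0
    have h := hd q ((ComplexShape.up ℕ).next q) x
    constructor
    · intro hx
      exact h.symm.trans ((congrArg _ hx).trans (map_zero _))
    · intro hx
      exact (e _).injective ((h.trans hx).trans (map_zero _).symm)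
  · change (∃ y, (C.d _ q).hom y = x) ↔ ∃ y, (C'.d _ q).hom y = e (.mk q) x
    constructor
    · rintro ⟨y, rfl⟩
      exact ⟨e _ y, (hd _ _ y).symm⟩
    · rintro ⟨y, hy⟩
      obtain ⟨z, rfl⟩ := (e _).surjective y
      exact ⟨z, (e (.mk q)).injective ((hd _ _ z).trans hy)⟩

variable {X : Type} [TopologicalSpace X] {x₀ : X}

/-- Applying a field automorphism to the values of sections of a rank one local system. -/
def stalkConjugate (σ : ℂ ≃+* ℂ) (τ : FundamentalGroup X x₀ →* ℂˣ) (x : FundamentalGroupoid X) :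
    inducedStalk τ x ≃+ inducedStalk ((Units.map (σ : ℂ →* ℂ)).comp τ) x where
  toFun s := ⟨fun p => σ (s.1 p), fun g p => by
    change σ (s.1 (g ≫ p)) = _
    rw [s.2 g p, map_mul, MonoidHom.comp_apply, ← map_inv (Units.map (σ : ℂ →* ℂ))]
    rfl⟩
  invFun s := ⟨fun p => σ.symm (s.1 p), fun g p => by
    change σ.symm (s.1 (g ≫ p)) = _
    rw [s.2 g p, map_mul, MonoidHom.comp_apply, ← map_inv (Units.map (σ : ℂ →* ℂ))]
    congr 1
    exact σ.symm_apply_apply _⟩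
  left_inv s := Subtype.ext (funext fun p => σ.symm_apply_apply _)
  right_inv s := Subtype.ext (funext fun p => σ.apply_symm_apply _)
  map_add' s t := Subtype.ext (funext fun p => map_add σ _ _)

theorem bettiLocal_inducedSystem_conjugate (σ : ℂ ≃+* ℂ) (τ : FundamentalGroup X x₀ →* ℂˣ)
    (q : ℕ) : bettiLocal (inducedSystem τ) q =
      bettiLocal (inducedSystem ((Units.map (σ : ℂ →* ℂ)).comp τ)) q := by
  refine rank_cohomology_eq_of_semilinearEquiv σ
    (V := cochains (inducedSystem τ))
    (V' := cochains (inducedSystem ((Units.map (σ : ℂ →* ℂ)).comp τ)))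
    (fun n => AddEquiv.piCongrRight fun f : C(Simplex n, X) =>
      stalkConjugate σ τ (.mk (f (vertexZero n)))) ?_ ?_ q
  · intro n a c
    exact funext fun f => Subtype.ext (funext fun p => map_mul σ _ _)
  · intro k n θ c
    -- Transport is precomposition in the path variable, whereas `σ` acts on values.
    rfl

end Semilinear

/-! ### Characters of paths and flat functions -/

section PathCharacter

/-- A homotopy invariant multiplicative function on the paths of a space. -/
structure PathCharacter (X : Type) [TopologicalSpace X] where
  /-- the value on a path -/
  val : ∀ {x y : X}, Path x y → ℂˣ
  val_trans : ∀ {x y z : X} (γ : Path x y) (δ : Path y z), val (γ.trans δ) = val γ * val δ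
  val_eq_of_homotopic : ∀ {x y : X} {γ δ : Path x y}, γ.Homotopic δ → val γ = val δ

namespace PathCharacter

variable {X : Type} [TopologicalSpace X]

/-- The path character given by a character of the fundamental group and a choice of paths from the
base point. -/
def ofCharacter [PathConnectedSpace X] {x₀ : X} (τ : FundamentalGroup X x₀ →* ℂˣ) :
    PathCharacter X where
  val {x y} γ := τ (FundamentalGroup.fromPath (Path.Homotopic.Quotient.mk
    (((PathConnectedSpace.somePath x₀ x).trans γ).trans (PathConnectedSpace.somePath x₀ y).symm)))
  val_trans {x y z} γ δ := by
    rw [mul_comm, ← map_mul, FundamentalGroup.mul_def]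
    congr 1
    simp only [Path.Homotopic.Quotient.mk_trans, Path.Homotopic.Quotient.mk_symm,
      Path.Homotopic.Quotient.trans_assoc]
    congr 2
    rw [← Path.Homotopic.Quotient.trans_assoc _ _ ((Path.Homotopic.Quotient.mk δ).trans _),
      Path.Homotopic.Quotient.symm_trans, Path.Homotopic.Quotient.refl_trans]
  val_eq_of_homotopic {x y γ δ} h := by
    simp only [Path.Homotopic.Quotient.mk_trans]
    rw [Path.Homotopic.Quotient.eq.2 h]

lemma ofCharacter_loop [PathConnectedSpace X] {x₀ : X} (τ : FundamentalGroup X x₀ →* ℂˣ)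
    (γ : Path x₀ x₀) : (ofCharacter τ).val γ =
      τ (FundamentalGroup.fromPath (Path.Homotopic.Quotient.mk γ)) := by
  let b : FundamentalGroup X x₀ := FundamentalGroup.fromPath
    (Path.Homotopic.Quotient.mk (PathConnectedSpace.somePath x₀ x₀))
  have : FundamentalGroup.fromPath (Path.Homotopic.Quotient.mk
      (((PathConnectedSpace.somePath x₀ x₀).trans γ).trans
        (PathConnectedSpace.somePath x₀ x₀).symm)) =
      b⁻¹ * (FundamentalGroup.fromPath (Path.Homotopic.Quotient.mk γ) * b) := rfl
  change τ _ = _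
  rw [this, map_mul, map_mul, map_inv, mul_comm, mul_inv_cancel_right]

variable (T : PathCharacter X)

lemma val_refl (x : X) : T.val (Path.refl x) = 1 := by
  have h := T.val_trans (Path.refl x) (Path.refl x)
  rw [T.val_eq_of_homotopic ⟨Path.Homotopy.transRefl (Path.refl x)⟩] at h
  exact mul_eq_left.1 h.symm

lemma val_cast {x y x' y' : X} (γ : Path x y) (hx : x' = x) (hy : y' = y) :
    T.val (γ.cast hx hy) = T.val γ := by
  subst hx hy
  rfl

lemma val_subpath_mul {x y : X} (γ : Path x y) (s t u : unitInterval) :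
    T.val (γ.subpath s t) * T.val (γ.subpath t u) = T.val (γ.subpath s u) := by
  rw [← T.val_trans]
  exact T.val_eq_of_homotopic ⟨Path.Homotopy.subpathTransSubpath γ s t u⟩

lemma val_subpath_zero_one {x y : X} (γ : Path x y) : T.val (γ.subpath 0 1) = T.val γ := by
  rw [Path.subpath_zero_one, val_cast]

/-- A function on `X` is flat on `S` if the path character is given on paths in `S` by ratios of its
values. -/
def Flat (g : X → ℂˣ) (S : Set X) : Prop :=
  ∀ ⦃x y : X⦄ (γ : Path x y), (∀ t, γ t ∈ S) → g y = T.val γ * g x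

variable {T}

lemma Flat.mono {g : X → ℂˣ} {S S' : Set X} (h : T.Flat g S) (hS : S' ⊆ S) : T.Flat g S' :=
  fun _ _ γ hγ => h γ fun t => hS (hγ t)

lemma Flat.congr {g g' : X → ℂˣ} {S : Set X} (h : T.Flat g S) (hg : ∀ x ∈ S, g' x = g x) :
    T.Flat g' S := by
  intro x y γ hγ
  rw [hg x (by simpa using hγ 0), hg y (by simpa using hγ 1)]
  exact h γ hγ

lemma Flat.mul_const {g : X → ℂˣ} {S : Set X} (h : T.Flat g S) (c : ℂˣ) :
    T.Flat (fun x => g x * c) S := fun x y γ hγ => by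
  change g y * c = T.val γ * (g x * c)
  rw [h γ hγ, mul_assoc]

/-- By a Lebesgue number argument a path in `S` splits into pieces each lying in one `U`;
multiplicativity of `T` assembles the local identities. -/
lemma flat_of_locally_flat {g : X → ℂˣ} {S : Set X}
    (h : ∀ x ∈ S, ∃ U, IsOpen U ∧ x ∈ U ∧ T.Flat g (U ∩ S)) : T.Flat g S := by
  intro x y γ hγ
  choose U hU hxU hflat using h
  obtain ⟨t, ht0, htmono, ⟨N, hN⟩, ht⟩ := exists_monotone_Icc_subset_open_cover_unitInterval
    (c := fun s : unitInterval => γ ⁻¹' (U (γ s) (hγ s)))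
    (fun s => (hU _ _).preimage γ.continuous) fun s _ => Set.mem_iUnion.2 ⟨s, hxU _ _⟩
  have key : ∀ n, g (γ (t n)) = T.val (γ.subpath 0 (t n)) * g (γ 0) := by
    intro n
    induction n with
    | zero => rw [ht0, Path.subpath_self, val_refl, one_mul]
    | succ n ih =>
      obtain ⟨s, hs⟩ := ht n
      have h1 : g (γ (t (n + 1))) = T.val (γ.subpath (t n) (t (n + 1))) * g (γ (t n)) := by
        refine hflat _ (hγ s) _ fun r => ?_
        have h2 : γ.subpath (t n) (t (n + 1)) r ∈ Set.range (γ.subpath (t n) (t (n + 1))) :=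
          ⟨r, rfl⟩
        rw [Path.range_subpath_of_le _ _ _ (htmono n.le_succ)] at h2
        obtain ⟨r', hr', h3⟩ := h2
        rw [← h3]
        exact ⟨hs hr', hγ r'⟩
      rw [h1, ih, ← mul_assoc, mul_comm (T.val _), val_subpath_mul]
  have h1 := key N
  rw [hN N le_rfl, val_subpath_zero_one, γ.source, γ.target] at h1
  exact h1

lemma exists_flat_union {S₁ S₂ : Set X} (h₁ : IsOpen S₁) (h₂ : IsOpen S₂) {g₁ g₂ : X → ℂˣ}
    (hg₁ : T.Flat g₁ S₁) (hg₂ : T.Flat g₂ S₂) (h : ∀ x ∈ S₁ ∩ S₂, g₁ x = g₂ x) :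
    ∃ g, T.Flat g (S₁ ∪ S₂) := by
  classical
  refine ⟨fun x => if x ∈ S₁ then g₁ x else g₂ x, flat_of_locally_flat ?_⟩
  rintro x (hx | hx)
  · refine ⟨S₁, h₁, hx, (hg₁.mono Set.inter_subset_left).congr fun y hy => if_pos hy.1⟩
  · refine ⟨S₂, h₂, hx, (hg₂.mono Set.inter_subset_left).congr fun y hy => ?_⟩
    split_ifs with hy'
    · exact h y ⟨hy', hy.1⟩
    · rfl

/-- The van Kampen argument for characters: on a path connected intersection two flat functions have
a constant ratio, so rescaling one makes them agree. -/
lemma exists_flat_union_of_joined {S₁ S₂ : Set X} (h₁ : IsOpen S₁) (h₂ : IsOpen S₂)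
    (hg₁ : ∃ g, T.Flat g S₁) (hg₂ : ∃ g, T.Flat g S₂)
    (h : ∀ x ∈ S₁ ∩ S₂, ∀ y ∈ S₁ ∩ S₂, JoinedIn (S₁ ∩ S₂) x y) :
    ∃ g, T.Flat g (S₁ ∪ S₂) := by
  obtain ⟨g₁, hg₁⟩ := hg₁
  obtain ⟨g₂, hg₂⟩ := hg₂
  by_cases hne : (S₁ ∩ S₂).Nonempty
  · obtain ⟨x, hx⟩ := hne
    refine exists_flat_union h₁ h₂ hg₁ (hg₂.mul_const ((g₂ x)⁻¹ * g₁ x)) fun y hy => ?_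
    obtain ⟨γ, hγ⟩ := h x hx y hy
    rw [hg₁ γ fun t => (hγ t).1, hg₂ γ fun t => (hγ t).2]
    rw [mul_assoc, mul_inv_cancel_left]
  · exact exists_flat_union h₁ h₂ hg₁ hg₂ fun y hy => (hne ⟨y, hy⟩).elim

lemma Flat.eq_of_joinedIn {S₁ S₂ : Set X} {g₁ g₂ : X → ℂˣ} (hg₁ : T.Flat g₁ S₁)
    (hg₂ : T.Flat g₂ S₂) {x y : X} (hx : g₁ x = g₂ x) (h : JoinedIn (S₁ ∩ S₂) x y) :
    g₁ y = g₂ y := by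
  obtain ⟨γ, hγ⟩ := h
  rw [hg₁ γ fun t => (hγ t).1, hg₂ γ fun t => (hγ t).2, hx]

lemma val_eq_of_map_homotopic {Y : Type} [TopologicalSpace Y] [SimplyConnectedSpace Y]
    (i : C(Y, X)) {a b : Y} (γ δ : Path a b) :
    T.val (γ.map i.continuous) = T.val (δ.map i.continuous) :=
  T.val_eq_of_homotopic ((SimplyConnectedSpace.paths_homotopic γ δ).map i)

-- On a simply connected piece, `T` along any path from a fixed base point is a well defined
-- primitive. The embedding is needed to lift paths in the range continuously to `Y`.
variable (T) in
lemma exists_flat_range {Y : Type} [TopologicalSpace Y] [SimplyConnectedSpace Y] {i : Y → X}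
    (hi : Topology.IsEmbedding i) : ∃ g, T.Flat g (Set.range i) := by
  classical
  let y₀ : Y := Classical.arbitrary Y
  let g : X → ℂˣ := fun x => if h : x ∈ Set.range i then
    T.val ((PathConnectedSpace.somePath y₀ h.choose).map hi.continuous) else 1
  have hg : ∀ y, g (i y) = T.val ((PathConnectedSpace.somePath y₀ y).map hi.continuous) := by
    intro y
    have h : i y ∈ Set.range i := ⟨y, rfl⟩
    have h1 : h.choose = y := hi.injective h.choose_spec
    simp only [g, dif_pos h]
    have : ∀ z, z = y → T.val ((PathConnectedSpace.somePath y₀ z).map hi.continuous) =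
        T.val ((PathConnectedSpace.somePath y₀ y).map hi.continuous) := by
      rintro z rfl
      rfl
    exact this _ h1
  refine ⟨g, fun x x' γ hγ => ?_⟩
  choose δ hδ using hγ
  have hδc : Continuous δ := by
    rw [hi.continuous_iff]
    exact (funext hδ : i ∘ δ = γ) ▸ γ.continuous
  have hx : x = i (δ 0) := by rw [hδ, γ.source]
  have hx' : x' = i (δ 1) := by rw [hδ, γ.target]
  subst hx hx'
  let δ' : Path (δ 0) (δ 1) := ⟨⟨δ, hδc⟩, rfl, rfl⟩
  have hmap : γ = δ'.map hi.continuous := Path.ext (funext fun t => (hδ t).symm)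
  rw [hg, hg, hmap, mul_comm, ← T.val_trans, ← Path.map_trans]
  exact val_eq_of_map_homotopic ⟨i, hi.continuous⟩ _ _

end PathCharacter

end PathCharacter

/-! ### Generic points and connectedness of complements -/

section GenericPosition

/-- A complex affine map as a real affine map. -/
def realAffineMap {V E : Type*} [AddCommGroup V] [Module ℂ V] [Module ℝ V] [IsScalarTower ℝ ℂ V]
    [AddCommGroup E] [Module ℂ E] [Module ℝ E] [IsScalarTower ℝ ℂ E] (φ : V →ᵃ[ℂ] E) :
    V →ᵃ[ℝ] E where
  toFun := φ
  linear := φ.linear.restrictScalars ℝ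
  map_vadd' := φ.map_vadd

lemma volume_preimage_submodule_eq_zero {ℓ : ℕ} {E : Type*} [AddCommGroup E] [Module ℂ E]
    [Module ℝ E] [IsScalarTower ℝ ℂ E] (φ : (Fin ℓ → ℂ) →ᵃ[ℂ] E) (hφ : Function.Surjective φ)
    {K : Submodule ℝ E} (hK : K ≠ ⊤) : MeasureTheory.volume (φ ⁻¹' (K : Set E)) = 0 := by
  let P : AffineSubspace ℝ (Fin ℓ → ℂ) := K.toAffineSubspace.comap (realAffineMap φ)
  refine MeasureTheory.Measure.addHaar_affineSubspace MeasureTheory.volume P fun hP => hK ?_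
  rw [eq_top_iff]
  intro e _
  obtain ⟨x, rfl⟩ := hφ e
  have : x ∈ P := hP ▸ AffineSubspace.mem_top ℝ _ x
  exact this

namespace Arrangement

variable {ι : Type} [Fintype ι] {ℓ : ℕ} (A : Arrangement ι ℓ)

omit [Fintype ι] in
lemma form_surjective (i : ι) : Function.Surjective (A.form i) := by
  rw [← (A.form i).linear_surjective_iff]
  exact LinearMap.surjective (A.form_linear_ne_zero i)

lemma isOpen_complement : IsOpen A.complement := by
  have : A.complement = ⋂ i, (A.form i) ⁻¹' {0}ᶜ := by
    ext x
    simp [mem_complement]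
  rw [this]
  exact isOpen_iInter_of_finite fun i => isOpen_compl_singleton.preimage (A.continuous_form i)

-- If a form vanished on the segment away from `a`, its value at `w` would be a real multiple of its
-- value at `a`. That is a condition of real codimension one on `w`, so it fails almost everywhere.
omit [Fintype ι] in
lemma segment_subset_complement {a w : Fin ℓ → ℂ} (ha : a ∈ A.complement)
    (hw : ∀ i, A.form i w ∉ Submodule.span ℝ {A.form i a}) : segment ℝ a w ⊆ A.complement := by
  rintro x ⟨r, s, hr, hs, hrs, rfl⟩
  rw [mem_complement] at ha ⊢
  intro i h0
  replace h0 := (Convex.combo_affine_apply hrs (f := realAffineMap (A.form i))).symm.trans h0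
  change r • A.form i a + s • A.form i w = 0 at h0
  rcases hs.eq_or_lt with rfl | hs
  · obtain rfl : r = 1 := by linarith
    exact ha i (by simpa using h0)
  · refine hw i (Submodule.mem_span_singleton.2 ⟨-(r / s), ?_⟩)
    have h1 : A.form i w = (s⁻¹ * s) • A.form i w := by
      rw [inv_mul_cancel₀ hs.ne', one_smul]
    rw [h1, mul_smul, eq_neg_of_add_eq_zero_right h0, smul_neg, smul_smul, neg_smul,
      div_eq_inv_mul]

lemma span_singleton_ne_top (z : ℂ) : Submodule.span ℝ {z} ≠ ⊤ := by
  intro h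
  have h1 := finrank_span_le_card (R := ℝ) ({z} : Set ℂ)
  rw [h, finrank_top, Complex.finrank_real_complex] at h1
  simp at h1

lemma ae_segment_subset_complement {a : Fin ℓ → ℂ} (ha : a ∈ A.complement) :
    ∀ᵐ w, segment ℝ a w ⊆ A.complement := by
  have : ∀ᵐ w, ∀ i, A.form i w ∉ Submodule.span ℝ {A.form i a} := by
    rw [MeasureTheory.ae_all_iff]
    intro i
    rw [MeasureTheory.ae_iff]
    simpa using! volume_preimage_submodule_eq_zero (A.form i) (A.form_surjective i)
      (span_singleton_ne_top (A.form i a))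
  filter_upwards [this] with w hw using A.segment_subset_complement ha hw

lemma ae_mem_complement : ∀ᵐ w, w ∈ A.complement := by
  have : ∀ᵐ w, ∀ i, A.form i w ∉ (⊥ : Submodule ℝ ℂ) := by
    rw [MeasureTheory.ae_all_iff]
    intro i
    rw [MeasureTheory.ae_iff]
    simpa using! volume_preimage_submodule_eq_zero (A.form i) (A.form_surjective i)
      (K := ⊥) bot_ne_top
  filter_upwards [this] with w hw using A.mem_complement.2 fun i hi => hw i hi

lemma exists_mem_of_ae {p : (Fin ℓ → ℂ) → Prop} (hp : ∀ᵐ w, p w) {W : Set (Fin ℓ → ℂ)}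
    (hW : IsOpen W) (hne : W.Nonempty) : ∃ w ∈ W, p w := by
  by_contra! h
  have h1 : MeasureTheory.volume W = 0 :=
    MeasureTheory.measure_mono_null (fun w hw => h w hw) (MeasureTheory.ae_iff.1 hp)
  exact (hW.measure_pos MeasureTheory.volume hne).ne' h1

/-- Complex hyperplanes do not disconnect an open convex set: almost every point `w` of `W` is
joined to both `x` and `y` by segments in the complement. -/
lemma joinedIn_preimage_of_convex {W : Set (Fin ℓ → ℂ)} (hW : IsOpen W) (hconv : Convex ℝ W)
    {x y : A.complement} (hx : (x : Fin ℓ → ℂ) ∈ W) (hy : (y : Fin ℓ → ℂ) ∈ W) :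
    JoinedIn (Subtype.val ⁻¹' W) x y := by
  obtain ⟨w, hwW, hxw, hyw⟩ := exists_mem_of_ae ((A.ae_segment_subset_complement x.2).and
    (A.ae_segment_subset_complement y.2)) hW ⟨x, hx⟩
  have h : JoinedIn (A.complement ∩ W) (x : Fin ℓ → ℂ) y :=
    (JoinedIn.of_segment_subset (Set.subset_inter hxw (hconv.segment_subset hx hwW))).trans
      (JoinedIn.of_segment_subset (Set.subset_inter hyw (hconv.segment_subset hy hwW))).symm
  obtain ⟨γ, hγ⟩ := h
  exact ⟨⟨⟨fun t => ⟨γ t, (hγ t).1⟩, by fun_prop⟩, Subtype.ext γ.source, Subtype.ext γ.target⟩,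
    fun t => (hγ t).2⟩

lemma pathConnectedSpace_complement (x₀ : A.complement) : PathConnectedSpace A.complement where
  nonempty := ⟨x₀⟩
  joined _ _ := (A.joinedIn_preimage_of_convex isOpen_univ convex_univ trivial trivial).joined

omit [Fintype ι] in
lemma exists_flat_of_starConvex (T : PathCharacter A.complement) {W : Set (Fin ℓ → ℂ)}
    {w : Fin ℓ → ℂ} (hW : StarConvex ℝ w W) (hne : W.Nonempty) (hWA : W ⊆ A.complement) :
    ∃ g, T.Flat g (Subtype.val ⁻¹' W) := by
  have := hW.contractibleSpace hne
  have h := T.exists_flat_range (Topology.IsEmbedding.inclusion hWA)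
  rwa [Set.range_inclusion] at h

end Arrangement

end GenericPosition

/-! ### Gluing flat functions along segments and triangles -/

section FlatNear

variable {ι : Type} [Fintype ι] {ℓ : ℕ} {A : Arrangement ι ℓ}

namespace PathCharacter

variable (T : PathCharacter A.complement)

/-- A path character of the complement of an arrangement is trivial near a set if it admits a flat
function on a uniform neighbourhood of this set. -/
def FlatNear (K : Set (Fin ℓ → ℂ)) : Prop :=
  ∃ δ > 0, ∃ g, T.Flat g (Subtype.val ⁻¹' Metric.thickening δ K)

variable {T}

omit [Fintype ι] in
lemma FlatNear.mono {K K' : Set (Fin ℓ → ℂ)} (h : T.FlatNear K) (hK : K' ⊆ K) :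
    T.FlatNear K' := by
  obtain ⟨δ, hδ, g, hg⟩ := h
  exact ⟨δ, hδ, g, hg.mono (Set.preimage_mono (Metric.thickening_subset_of_subset δ hK))⟩

/-- Convexity makes the intersection of the thickenings convex, so it stays connected after removing
the hyperplanes. The sets `K₁`, `K₂` themselves may meet the hyperplanes. -/
lemma FlatNear.union {K₁ K₂ : Set (Fin ℓ → ℂ)} (h₁ : T.FlatNear K₁) (h₂ : T.FlatNear K₂)
    (hK₁ : Convex ℝ K₁) (hK₂ : Convex ℝ K₂) : T.FlatNear (K₁ ∪ K₂) := by
  obtain ⟨δ₁, hδ₁, g₁, hg₁⟩ := h₁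
  obtain ⟨δ₂, hδ₂, g₂, hg₂⟩ := h₂
  refine ⟨min δ₁ δ₂, lt_min hδ₁ hδ₂, ?_⟩
  rw [Metric.thickening_union, Set.preimage_union]
  refine exists_flat_union_of_joined (Metric.isOpen_thickening.preimage continuous_subtype_val)
    (Metric.isOpen_thickening.preimage continuous_subtype_val)
    ⟨g₁, hg₁.mono (Set.preimage_mono (Metric.thickening_mono (min_le_left _ _) _))⟩
    ⟨g₂, hg₂.mono (Set.preimage_mono (Metric.thickening_mono (min_le_right _ _) _))⟩ ?_
  intro x hx y hy
  exact A.joinedIn_preimage_of_convex (Metric.isOpen_thickening.inter Metric.isOpen_thickening)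
    ((hK₁.thickening _).inter (hK₂.thickening _)) hx hy

omit [Fintype ι] in
lemma flatNear_of_subset_thickening {K K' : Set (Fin ℓ → ℂ)} {δ : ℝ} (hδ : 0 < δ)
    {g : A.complement → ℂˣ} (hg : T.Flat g (Subtype.val ⁻¹' Metric.thickening δ K))
    (hK : K' ⊆ Metric.thickening (δ / 2) K) : T.FlatNear K' := by
  refine ⟨δ / 2, half_pos hδ, g, hg.mono (Set.preimage_mono ?_)⟩
  refine (Metric.thickening_subset_of_subset _ hK).trans
    ((Metric.thickening_thickening_subset _ _ _).trans ?_)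
  rw [add_halves]

/-- Flatness near `F t` covers all nearby slices, so finitely many parameter intervals suffice. They
are added one at a time, and `hconv` lets `FlatNear.union` apply to each new slab. -/
lemma flatNear_iUnion {F : unitInterval → Set (Fin ℓ → ℂ)}
    (hconv : ∀ s t, Convex ℝ (⋃ u ∈ Set.Icc s t, F u))
    (hF : ∀ t, ∀ δ > 0, ∀ᶠ u in nhds t, F u ⊆ Metric.thickening δ (F t))
    (h : ∀ t, T.FlatNear (F t)) : T.FlatNear (⋃ u, F u) := by
  choose δ hδ g hg using h
  have hU : ∀ t, ∃ U : Set unitInterval, IsOpen U ∧ t ∈ U ∧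
      ∀ u ∈ U, F u ⊆ Metric.thickening (δ t / 2) (F t) := by
    intro t
    obtain ⟨U, hU, hUo, htU⟩ := mem_nhds_iff.1 (hF t _ (half_pos (hδ t)))
    exact ⟨U, hUo, htU, fun u hu => hU hu⟩
  choose U hUo htU hUF using hU
  obtain ⟨t, ht0, htmono, ⟨N, hN⟩, ht⟩ := exists_monotone_Icc_subset_open_cover_unitInterval
    hUo fun s _ => Set.mem_iUnion.2 ⟨s, htU s⟩
  have key : ∀ n, T.FlatNear (⋃ u ∈ Set.Icc 0 (t n), F u) := by
    intro n
    induction n with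
    | zero =>
      refine FlatNear.mono ⟨δ 0, hδ 0, g 0, hg 0⟩ ?_
      simp only [ht0, Set.Icc_self]
      simp
    | succ n ih =>
      obtain ⟨s, hs⟩ := ht n
      have h1 : T.FlatNear (⋃ u ∈ Set.Icc (t n) (t (n + 1)), F u) :=
        flatNear_of_subset_thickening (hδ s) (hg s)
          (Set.iUnion₂_subset fun u hu => hUF s u (hs hu))
      refine (ih.union h1 (hconv _ _) (hconv _ _)).mono ?_
      rw [← Set.biUnion_union, Set.Icc_union_Icc_eq_Icc (by simp) (htmono n.le_succ)]
  refine (key N).mono ?_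
  rw [hN N le_rfl]
  exact Set.iUnion_subset fun u => Set.subset_biUnion_of_mem ⟨u.2.1, u.2.2⟩

/-- The points on a segment, parametrised by the unit interval. -/
def segmentPoint (a b : Fin ℓ → ℂ) (t : unitInterval) : Fin ℓ → ℂ :=
  AffineMap.lineMap a b (t : ℝ)

lemma continuous_segmentPoint (a b : Fin ℓ → ℂ) : Continuous (segmentPoint a b) := by
  unfold segmentPoint
  simp only [AffineMap.lineMap_apply_module]
  fun_prop

lemma iUnion_segmentPoint (a b : Fin ℓ → ℂ) : ⋃ t, {segmentPoint a b t} = segment ℝ a b := by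
  rw [segment_eq_image_lineMap]
  ext x
  simp [segmentPoint, eq_comm]

lemma convex_iUnion_segmentPoint (a b : Fin ℓ → ℂ) (s t : unitInterval) :
    Convex ℝ (⋃ u ∈ Set.Icc s t, {segmentPoint a b u}) := by
  have : (⋃ u ∈ Set.Icc s t, {segmentPoint a b u}) =
      (AffineMap.lineMap a b : ℝ →ᵃ[ℝ] _) '' Set.Icc (s : ℝ) t := by
    ext x
    simp only [Set.mem_iUnion, Set.mem_singleton_iff, Set.mem_image, segmentPoint]
    constructor
    · rintro ⟨u, hu, rfl⟩
      exact ⟨u, hu, rfl⟩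
    · rintro ⟨u, hu, rfl⟩
      exact ⟨⟨u, s.2.1.trans hu.1, hu.2.trans t.2.2⟩, hu, rfl⟩
  rw [this]
  exact (convex_Icc _ _).affine_image _

lemma flatNear_segment {a b : Fin ℓ → ℂ} (h : ∀ p ∈ segment ℝ a b, T.FlatNear {p}) :
    T.FlatNear (segment ℝ a b) := by
  rw [← iUnion_segmentPoint]
  refine flatNear_iUnion (convex_iUnion_segmentPoint a b) (fun t δ hδ => ?_) fun t => h _ ?_
  · filter_upwards [(continuous_segmentPoint a b).continuousAt.eventually
      (Metric.ball_mem_nhds _ hδ)] with u hu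
    rw [Metric.thickening_singleton]
    exact Set.singleton_subset_iff.2 hu
  · rw [← iUnion_segmentPoint]
    exact Set.mem_iUnion.2 ⟨t, rfl⟩

/-- The triangle is swept by the segments from the apex `c` to the points of the side from `a` to
`b`. -/
lemma flatNear_triangle {a b c : Fin ℓ → ℂ}
    (h : ∀ p ∈ convexHull ℝ {c, a, b}, T.FlatNear {p}) : T.FlatNear (convexHull ℝ {c, a, b}) := by
  have hne : ({a, b} : Set (Fin ℓ → ℂ)).Nonempty := ⟨a, by simp⟩
  have heq : ∀ S : Set unitInterval, (⋃ u ∈ S, segment ℝ c (segmentPoint a b u)) =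
      convexJoin ℝ {c} (⋃ u ∈ S, {segmentPoint a b u}) := by
    intro S
    simp only [convexJoin_iUnion_right, convexJoin_singletons]
  have htri : (⋃ u, segment ℝ c (segmentPoint a b u)) = convexHull ℝ {c, a, b} := by
    rw [convexHull_insert hne, convexHull_pair, ← iUnion_segmentPoint]
    simp only [convexJoin_iUnion_right, convexJoin_singletons]
  rw [← htri]
  refine flatNear_iUnion (fun s t => ?_) (fun t δ hδ => ?_) fun t => flatNear_segment fun p hp =>
    h p ?_
  · rw [heq]
    exact (convex_singleton c).convexJoin (convex_iUnion_segmentPoint a b s t)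
  · filter_upwards [(continuous_segmentPoint a b).continuousAt.eventually
      (Metric.ball_mem_nhds _ hδ)] with u hu
    refine ((convex_segment c _).thickening δ).segment_subset
      (Metric.self_subset_thickening hδ _ (left_mem_segment ℝ _ _)) ?_
    exact Metric.mem_thickening_iff.2 ⟨_, right_mem_segment ℝ _ _, hu⟩
  · rw [← htri]
    exact Set.mem_iUnion.2 ⟨t, hp⟩

end PathCharacter

end FlatNear

/-! ### Trivial meridians give flat functions near generic points of a hyperplane -/

section LocalTriviality

variable {ι : Type} [Fintype ι] {ℓ : ℕ} {A : Arrangement ι ℓ}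

namespace PathCharacter

variable (T : PathCharacter A.complement)

/-- The path character takes the value one on the positively oriented boundary circles of discs
transverse to a hyperplane. -/
def TrivialOnCircles : Prop :=
  ∀ (i : ι) (p v : Fin ℓ → ℂ) (y : A.complement) (σ : Path y y),
    p ∈ A.hyperplane i → (A.form i).linear v ≠ 0 →
    (∀ j, j ≠ i → ∀ t : ℂ, ‖t‖ ≤ 1 → p + t • v ∉ A.hyperplane j) →
    (∀ s : unitInterval, (σ s : Fin ℓ → ℂ) =
      p + Complex.exp (2 * Real.pi * Complex.I * (s : ℝ)) • v) → T.val σ = 1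

omit [Fintype ι] in
lemma flatNear_of_ball_subset {p : Fin ℓ → ℂ} {ε : ℝ} (hε : 0 < ε)
    (h : Metric.ball p ε ⊆ A.complement) : T.FlatNear {p} := by
  refine ⟨ε, hε, ?_⟩
  rw [Metric.thickening_singleton]
  exact A.exists_flat_of_starConvex T ((convex_ball p ε).starConvex (Metric.mem_ball_self hε))
    ⟨p, Metric.mem_ball_self hε⟩ h

lemma flatNear_of_mem_complement {p : Fin ℓ → ℂ} (hp : p ∈ A.complement) : T.FlatNear {p} := by
  obtain ⟨ε, hε, h⟩ := Metric.isOpen_iff.1 A.isOpen_complement p hp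
  exact T.flatNear_of_ball_subset hε h

/-- The circle through `1 - i`, started there, avoids the ray `-i[0, ∞)` during its first three
quarters. -/
lemma cos_add_sin_ne_zero_or {s : ℝ} (h0 : 0 ≤ s) (h1 : s ≤ 3 / 4) :
    0 < Real.sin (2 * Real.pi * s) - Real.cos (2 * Real.pi * s) ∨
      Real.cos (2 * Real.pi * s) + Real.sin (2 * Real.pi * s) ≠ 0 := by
  by_contra! h
  obtain ⟨h2, h3⟩ := h
  have hpi := Real.pi_pos
  have hsq := Real.sin_sq_add_cos_sq (2 * Real.pi * s)
  rcases le_total s (1 / 2) with hs | hs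
  · have : 0 ≤ Real.sin (2 * Real.pi * s) :=
      Real.sin_nonneg_of_nonneg_of_le_pi (by positivity) (by nlinarith)
    nlinarith
  · have : Real.cos (2 * Real.pi * s) ≤ 0 :=
      Real.cos_nonpos_of_pi_div_two_le_of_le (by nlinarith) (by nlinarith)
    nlinarith

lemma sin_sub_cos_neg {s : ℝ} (h0 : 3 / 4 ≤ s) (h1 : s ≤ 1) :
    Real.sin (2 * Real.pi * s) - Real.cos (2 * Real.pi * s) < 0 := by
  have hpi := Real.pi_pos
  have hsq := Real.sin_sq_add_cos_sq (2 * Real.pi * s)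
  have hs : Real.sin (2 * Real.pi * s) ≤ 0 := by
    rw [← Real.sin_sub_two_pi]
    exact Real.sin_nonpos_of_nonpos_of_neg_pi_le (by nlinarith) (by nlinarith)
  have hc : 0 ≤ Real.cos (2 * Real.pi * s) := by
    rw [← Real.cos_sub_two_pi]
    exact Real.cos_nonneg_of_neg_pi_div_two_le_of_le (by nlinarith) (by nlinarith)
  nlinarith

variable {T}

/-- Write `α` for the form of index `i`. The punctured ball is covered by the star-shaped set `W`,
where `α` avoids the ray `-i[0, ∞)`, and the convex set `V`, where `Im α < 0`. Each carries a flat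
function. They are normalised to agree where `Re α > 0` on `W ∩ V`; agreement on the other part,
where `Re α < 0`, is exactly triviality on the meridian circle. -/
lemma flatNear_of_mem_hyperplane (hT : T.TrivialOnCircles) {i : ι} {p : Fin ℓ → ℂ}
    (hp : A.form i p = 0) (hpj : ∀ j, j ≠ i → A.form j p ≠ 0) : T.FlatNear {p} := by
  obtain ⟨ε, hε, hball⟩ : ∃ ε > 0, ∀ x ∈ Metric.ball p ε, ∀ j, j ≠ i → A.form j x ≠ 0 := by
    have : ∀ᶠ x in nhds p, ∀ j, j ≠ i → A.form j x ≠ 0 := by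
      rw [Filter.eventually_all]
      intro j
      by_cases hj : j = i
      · exact Filter.Eventually.of_forall fun x h => (h hj).elim
      · exact ((A.continuous_form j).continuousAt.eventually_ne (hpj j hj)).mono fun x hx _ => hx
    exact Metric.eventually_nhds_iff_ball.1 this
  obtain ⟨u, hu⟩ := LinearMap.surjective (A.form_linear_ne_zero i) 1
  have hform : ∀ z : ℂ, A.form i (p + z • u) = z := by
    intro z
    rw [add_comm, ← vadd_eq_add, AffineMap.map_vadd, hp, map_smul, hu]
    simp
  -- Chosen so that `p + z • u` stays in the ball for `‖z‖ ≤ 2 * r`; the radius `‖c‖` of the circle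
  -- below is within this bound.
  set r : ℝ := ε / (2 * (‖u‖ + 1)) with hr_def
  have hr : 0 < r := by positivity
  have hru : ∀ z : ℂ, ‖z‖ ≤ 2 * r → p + z • u ∈ Metric.ball p ε := by
    intro z hz
    rw [mem_ball_iff_norm, add_sub_cancel_left, norm_smul]
    have h1 : 2 * r * (‖u‖ + 1) = ε := by
      rw [hr_def]
      field_simp
    nlinarith [norm_nonneg u, norm_nonneg z]
  let c : ℂ := r * (1 - Complex.I)
  have hc : c ≠ 0 := by
    refine mul_ne_zero (Complex.ofReal_ne_zero.2 hr.ne') fun h => ?_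
    have := congrArg Complex.re h
    simp at this
  have hcn : ‖c‖ ≤ 2 * r := by
    have h1 : ‖(1 : ℂ) - Complex.I‖ ≤ 2 := (norm_sub_le _ _).trans (by norm_num)
    rw [norm_mul, Complex.norm_real, Real.norm_of_nonneg hr.le]
    nlinarith
  let v : Fin ℓ → ℂ := c • u
  have hv : (A.form i).linear v ≠ 0 := by
    change (A.form i).linear (c • u) ≠ 0
    rw [map_smul, hu]
    simpa using hc
  have hdisc : ∀ t : ℂ, ‖t‖ ≤ 1 → p + t • v ∈ Metric.ball p ε := by
    intro t ht
    rw [smul_smul]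
    apply hru
    rw [norm_mul]
    nlinarith [norm_nonneg t, norm_nonneg c]
  have hmem : ∀ z : ℂ, ‖z‖ = 1 → p + z • v ∈ A.complement := by
    intro z hz
    rw [A.mem_complement]
    intro j
    by_cases hj : j = i
    · subst hj
      rw [smul_smul, hform]
      refine mul_ne_zero (fun h => ?_) hc
      rw [h, norm_zero] at hz
      exact zero_ne_one hz
    · exact hball _ (hdisc z hz.le) j hj
  have hexp : ∀ s : ℝ, Complex.exp (2 * Real.pi * Complex.I * s) =
      Real.cos (2 * Real.pi * s) + Real.sin (2 * Real.pi * s) * Complex.I := by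
    intro s
    rw [Complex.ofReal_cos, Complex.ofReal_sin, ← Complex.exp_mul_I]
    congr 1
    push_cast
    ring
  have hnorm : ∀ s : ℝ, ‖Complex.exp (2 * Real.pi * Complex.I * s)‖ = 1 := by
    intro s
    rw [Complex.norm_exp]
    simp
  let y : A.complement := ⟨p + v, by simpa using hmem 1 (by simp)⟩
  let σ : Path y y :=
    { toFun := fun s => ⟨p + Complex.exp (2 * Real.pi * Complex.I * (s : ℝ)) • v, hmem _ (hnorm _)⟩
      continuous_toFun := by fun_prop
      source' := by
        apply Subtype.ext
        simp [y]
      target' := by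
        apply Subtype.ext
        simp [y, Complex.exp_two_pi_mul_I] }
  have hσ1 : T.val σ = 1 := hT i p v y σ hp hv
    (fun j hj t ht => hball _ (hdisc t ht) j hj) fun s => rfl
  have hσball : ∀ s, (σ s : Fin ℓ → ℂ) ∈ Metric.ball p ε := fun s => hdisc _ (hnorm _).le
  have hσform : ∀ s : unitInterval, A.form i (σ s) =
      ((r * (Real.cos (2 * Real.pi * s) + Real.sin (2 * Real.pi * s)) : ℝ) : ℂ) +
        ((r * (Real.sin (2 * Real.pi * s) - Real.cos (2 * Real.pi * s)) : ℝ) : ℂ) * Complex.I := by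
    intro s
    change A.form i (p + Complex.exp (2 * Real.pi * Complex.I * (s : ℝ)) • c • u) = _
    rw [smul_smul, hform, hexp]
    push_cast
    linear_combination -(r : ℂ) * Complex.sin (2 * Real.pi * (s : ℝ)) * Complex.I_sq
  have hσre : ∀ s : unitInterval, (A.form i (σ s)).re =
      r * (Real.cos (2 * Real.pi * s) + Real.sin (2 * Real.pi * s)) := by
    intro s
    rw [hσform, Complex.add_re, Complex.ofReal_re, Complex.re_ofReal_mul, Complex.I_re, mul_zero,
      add_zero]
  have hσim : ∀ s : unitInterval, (A.form i (σ s)).im =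
      r * (Real.sin (2 * Real.pi * s) - Real.cos (2 * Real.pi * s)) := by
    intro s
    rw [hσform, Complex.add_im, Complex.ofReal_im, Complex.im_ofReal_mul, Complex.I_im, mul_one,
      zero_add]
  let W : Set (Fin ℓ → ℂ) := {x | x ∈ Metric.ball p ε ∧ (0 < (A.form i x).im ∨ (A.form i x).re ≠ 0)}
  let V : Set (Fin ℓ → ℂ) := {x | x ∈ Metric.ball p ε ∧ (A.form i x).im < 0}
  have hα : Continuous (A.form i) := A.continuous_form i
  have hWo : IsOpen W := Metric.isOpen_ball.inter
    ((isOpen_lt continuous_const (Complex.continuous_im.comp hα)).union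
      (isOpen_ne_fun (Complex.continuous_re.comp hα) continuous_const))
  have hVo : IsOpen V := Metric.isOpen_ball.inter
    (isOpen_lt (Complex.continuous_im.comp hα) continuous_const)
  have hmemA : ∀ x ∈ Metric.ball p ε, A.form i x ≠ 0 → x ∈ A.complement := by
    intro x hx hx0
    rw [A.mem_complement]
    intro j
    by_cases hj : j = i
    · exact hj ▸ hx0
    · exact hball x hx j hj
  have hWA : W ⊆ A.complement := by
    rintro x ⟨hx, hx'⟩
    refine hmemA x hx fun h0 => ?_
    rw [h0] at hx'
    simp at hx'
  have hVA : V ⊆ A.complement := by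
    rintro x ⟨hx, hx'⟩
    refine hmemA x hx fun h0 => ?_
    rw [h0] at hx'
    simp at hx'
  have hVconv : Convex ℝ V := (convex_ball p ε).inter
    ((convex_halfSpace_im_lt 0).affine_preimage (realAffineMap (A.form i)))
  have hyV : (y : Fin ℓ → ℂ) ∈ V := by
    refine ⟨by simpa [σ, y] using hσball 0, ?_⟩
    have := hσim 0
    rw [σ.source] at this
    rw [this]
    simpa using hr
  obtain ⟨g₁, hg₁⟩ : ∃ g, T.Flat g (Subtype.val ⁻¹' W) := by
    have hrI : ‖(r : ℂ) * Complex.I‖ ≤ 2 * r := by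
      rw [norm_mul, Complex.norm_real, Complex.norm_I, Real.norm_of_nonneg hr.le]
      linarith
    have hq : p + ((r : ℂ) * Complex.I) • u ∈ W := by
      refine ⟨hru _ hrI, Or.inl ?_⟩
      rw [hform]
      simpa using hr
    refine A.exists_flat_of_starConvex T (w := p + ((r : ℂ) * Complex.I) • u) ?_ ⟨_, hq⟩ hWA
    intro x hx a b ha hb hab
    refine ⟨convex_ball p ε hq.1 hx.1 ha hb hab, ?_⟩
    have h1 : A.form i (a • (p + ((r : ℂ) * Complex.I) • u) + b • x) =
        a • ((r : ℂ) * Complex.I) + b • A.form i x := by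
      refine (Convex.combo_affine_apply hab (f := realAffineMap (A.form i))).trans ?_
      change a • A.form i (p + ((r : ℂ) * Complex.I) • u) + b • A.form i x = _
      rw [hform]
    rw [h1]
    simp only [Complex.add_im, Complex.real_smul, Complex.im_ofReal_mul, Complex.I_im, mul_one,
      Complex.add_re, Complex.re_ofReal_mul, Complex.I_re, mul_zero, zero_add]
    rcases hb.eq_or_lt with rfl | hb
    · left
      obtain rfl : a = 1 := by linarith
      simpa using hr
    · rcases hx.2 with h | h
      · left
        positivity
      · exact Or.inr (mul_ne_zero hb.ne' h)
  obtain ⟨g₂, hg₂⟩ : ∃ g, T.Flat g (Subtype.val ⁻¹' V) :=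
    A.exists_flat_of_starConvex T (hVconv.starConvex hyV) ⟨_, hyV⟩ hVA
  let g₃ : A.complement → ℂˣ := fun x => g₂ x * ((g₂ y)⁻¹ * g₁ y)
  have hg₃ : T.Flat g₃ (Subtype.val ⁻¹' V) := hg₂.mul_const _
  have hy : g₁ y = g₃ y := (mul_inv_cancel_left _ _).symm
  -- At this time `α = r(-1 - i)`: the circle has run inside `W` from `r(1 - i)` and spends its last
  -- quarter inside `V`.
  let s₀ : unitInterval := ⟨3 / 4, by norm_num, by norm_num⟩
  have hsub₁ : g₁ (σ s₀) = T.val (σ.subpath 0 s₀) * g₁ (σ 0) := by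
    refine hg₁ _ fun t => ?_
    have h1 : σ.subpath 0 s₀ t ∈ Set.range (σ.subpath 0 s₀) := ⟨t, rfl⟩
    rw [Path.range_subpath_of_le _ _ _ s₀.2.1] at h1
    obtain ⟨s, hs, h2⟩ := h1
    rw [← h2]
    refine ⟨hσball s, ?_⟩
    rw [hσre, hσim]
    rcases cos_add_sin_ne_zero_or hs.1 hs.2 with h | h
    · exact Or.inl (mul_pos hr h)
    · exact Or.inr (mul_ne_zero hr.ne' h)
  have hsub₂ : g₃ (σ 1) = T.val (σ.subpath s₀ 1) * g₃ (σ s₀) := by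
    refine hg₃ _ fun t => ?_
    have h1 : σ.subpath s₀ 1 t ∈ Set.range (σ.subpath s₀ 1) := ⟨t, rfl⟩
    rw [Path.range_subpath_of_le _ _ _ s₀.2.2] at h1
    obtain ⟨s, hs, h2⟩ := h1
    rw [← h2]
    refine ⟨hσball s, ?_⟩
    rw [hσim]
    exact mul_neg_of_pos_of_neg hr (sin_sub_cos_neg hs.1 s.2.2)
  have hy' : g₁ (σ s₀) = g₃ (σ s₀) := by
    have h1 := T.val_subpath_mul σ 0 s₀ 1
    rw [val_subpath_zero_one, hσ1] at h1
    have h2 : g₁ (σ 0) = g₃ (σ 1) :=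
      (congrArg g₁ σ.source).trans (hy.trans (congrArg g₃ σ.target).symm)
    rw [hsub₁, h2, hsub₂, ← mul_assoc, h1, one_mul]
  have hVre : ∀ S : Set ℂ, Convex ℝ S → IsOpen S → (∃ e : A.complement, g₁ e = g₃ e ∧
      (e : Fin ℓ → ℂ) ∈ V ∧ A.form i e ∈ S ∧ ∀ z ∈ S, z.re ≠ 0) →
      ∀ x : A.complement, (x : Fin ℓ → ℂ) ∈ V → A.form i x ∈ S → g₁ x = g₃ x := by
    rintro S hSc hSo ⟨e, he, heV, heS, hS⟩ x hxV hxS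
    have hj : JoinedIn (Subtype.val ⁻¹' (V ∩ A.form i ⁻¹' S)) e x :=
      A.joinedIn_preimage_of_convex (hVo.inter (hSo.preimage hα))
        (hVconv.inter (hSc.affine_preimage (realAffineMap (A.form i)))) ⟨heV, heS⟩ ⟨hxV, hxS⟩
    refine hg₁.eq_of_joinedIn hg₃ he (hj.mono fun w hw => ⟨⟨hw.1.1, Or.inr (hS _ hw.2)⟩, hw.1⟩)
  have hagree : ∀ x ∈ Subtype.val ⁻¹' W ∩ Subtype.val ⁻¹' V, g₁ x = g₃ x := by
    rintro x ⟨⟨-, hxW⟩, hxV⟩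
    rcases (hxW.resolve_left hxV.2.not_gt).lt_or_gt with h | h
    · refine hVre {z | z.re < 0} (convex_halfSpace_re_lt 0)
        (isOpen_lt Complex.continuous_re continuous_const)
        ⟨σ s₀, hy', ⟨hσball s₀, ?_⟩, ?_, fun z hz => ne_of_lt hz⟩ x hxV h
      · rw [hσim]
        exact mul_neg_of_pos_of_neg hr (sin_sub_cos_neg le_rfl s₀.2.2)
      · change (A.form i (σ s₀)).re < 0
        rw [hσre]
        have h1 : 2 * Real.pi * ((s₀ : unitInterval) : ℝ) = Real.pi / 2 + Real.pi := by
          change 2 * Real.pi * (3 / 4) = _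
          ring
        rw [h1, Real.cos_add_pi, Real.sin_add_pi, Real.cos_pi_div_two, Real.sin_pi_div_two]
        nlinarith
    · refine hVre {z | 0 < z.re} (convex_halfSpace_re_gt 0)
        (isOpen_lt continuous_const Complex.continuous_re)
        ⟨y, hy, hyV, ?_, fun z hz => ne_of_gt hz⟩ x hxV h
      change 0 < (A.form i y).re
      rw [← σ.source, hσre]
      simpa using hr
  obtain ⟨g, hg⟩ := exists_flat_union (hWo.preimage continuous_subtype_val)
    (hVo.preimage continuous_subtype_val) hg₁ hg₃ hagree
  refine ⟨ε, hε, g, hg.mono fun x hx => ?_⟩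
  rw [Set.mem_preimage, Metric.thickening_singleton] at hx
  have hx0 := A.mem_complement.1 x.2 i
  by_cases him : (A.form i x).im < 0
  · exact Or.inr ⟨hx, him⟩
  · refine Or.inl ⟨hx, ?_⟩
    by_contra! h
    exact hx0 (Complex.ext h.2 (le_antisymm h.1 (not_lt.1 him)))

end PathCharacter

end LocalTriviality

/-! ### Coning off loops: uniqueness of the meridian character -/

section Uniqueness

variable {ι : Type} [Fintype ι] {ℓ : ℕ} (A : Arrangement ι ℓ)

namespace Arrangement

-- The direction `x - p` is killed by the linear part of form `i` and not by that of form `j`.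
-- Together with a vector `u` on which the former is one, it gives a triangular system.
omit [Fintype ι] in
lemma exists_linear_eq_zero_ne_zero {i j : ι} {p : Fin ℓ → ℂ} (hi : A.form i p = 0)
    (hj : A.form j p = 0) {x : Fin ℓ → ℂ} (hx : A.form i x = 0) (hx' : A.form j x ≠ 0) :
    Function.Surjective ((A.form i).prod (A.form j)) := by
  have key : ∀ (k : ι) (v : Fin ℓ → ℂ), A.form k p = 0 →
      A.form k (v + p) = (A.form k).linear v := by
    intro k v hk
    rw [← vadd_eq_add, AffineMap.map_vadd, hk]
    simp
  have hv : (A.form i).linear (x - p) = 0 := by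
    rw [← key i _ hi, sub_add_cancel, hx]
  have hv' : (A.form j).linear (x - p) ≠ 0 := by
    rwa [← key j _ hj, sub_add_cancel]
  obtain ⟨u, hu⟩ := LinearMap.surjective (A.form_linear_ne_zero i) 1
  rintro ⟨a, b⟩
  refine ⟨(a • u + ((b - a * (A.form j).linear u) / (A.form j).linear (x - p)) • (x - p)) + p, ?_⟩
  rw [AffineMap.prod_apply, key i _ hi, key j _ hj, map_add, map_add, map_smul, map_smul, map_smul,
    map_smul, hu, hv]
  simp only [smul_eq_mul, mul_one, mul_zero, add_zero, Prod.mk.injEq, true_and]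
  rw [div_mul_cancel₀ _ hv']
  ring

omit [Fintype ι] in
lemma prod_form_surjective {i j : ι} (hij : i ≠ j) {p : Fin ℓ → ℂ} (hi : A.form i p = 0)
    (hj : A.form j p = 0) : Function.Surjective ((A.form i).prod (A.form j)) := by
  by_cases h : ∃ x, A.form i x = 0 ∧ A.form j x ≠ 0
  · obtain ⟨x, hx, hx'⟩ := h
    exact A.exists_linear_eq_zero_ne_zero hi hj hx hx'
  · by_cases h' : ∃ x, A.form j x = 0 ∧ A.form i x ≠ 0
    · obtain ⟨x, hx, hx'⟩ := h'
      rintro ⟨a, b⟩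
      obtain ⟨w, hw⟩ := A.exists_linear_eq_zero_ne_zero hj hi hx hx' ⟨b, a⟩
      rw [AffineMap.prod_apply, Prod.mk.injEq] at hw
      exact ⟨w, Prod.ext hw.2 hw.1⟩
    · push Not at h h'
      exact (hij (A.hyperplane_injective (Set.ext fun x => ⟨h x, h' x⟩))).elim

omit [Fintype ι] in
lemma span_pair_ne_top (z w : ℂ × ℂ) : Submodule.span ℝ {z, w} ≠ ⊤ := by
  classical
  intro h
  have h1 := finrank_span_le_card (R := ℝ) ({z, w} : Set (ℂ × ℂ))
  rw [h, finrank_top, Module.finrank_prod, Complex.finrank_real_complex] at h1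
  have h2 : ({z, w} : Set (ℂ × ℂ)).toFinset.card ≤ 2 := by
    rw [Set.toFinset_insert, Set.toFinset_singleton]
    exact Finset.card_le_two
  omega

/-- Suppose a triangle point lies on two distinct hyperplanes. Either it has weight zero at `c` and
lies on the segment, excluded by `hab`, or the pair of forms at `c` lies in the real span of its
values at `a` and `b`. This span has real dimension at most two in `ℂ × ℂ`, so almost every `c`
avoids it. -/
lemma ae_triangle_meets_at_most_one (a b : Fin ℓ → ℂ) (hab : segment ℝ a b ⊆ A.complement) :
    ∀ᵐ c, ∀ p ∈ convexHull ℝ {c, a, b}, ∀ i j, A.form i p = 0 → A.form j p = 0 → i = j := by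
  have h : ∀ᵐ c, ∀ i j, Function.Surjective ((A.form i).prod (A.form j)) →
      (A.form i).prod (A.form j) c ∉
        Submodule.span ℝ {(A.form i).prod (A.form j) a, (A.form i).prod (A.form j) b} := by
    rw [MeasureTheory.ae_all_iff]
    intro i
    rw [MeasureTheory.ae_all_iff]
    intro j
    by_cases hs : Function.Surjective ((A.form i).prod (A.form j))
    · have : ∀ᵐ c, (A.form i).prod (A.form j) c ∉
          Submodule.span ℝ {(A.form i).prod (A.form j) a, (A.form i).prod (A.form j) b} := by
        rw [MeasureTheory.ae_iff]
        simpa using! volume_preimage_submodule_eq_zero _ hs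
          (span_pair_ne_top ((A.form i).prod (A.form j) a) ((A.form i).prod (A.form j) b))
      filter_upwards [this] with c hc _ using hc
    · exact Filter.Eventually.of_forall fun c h => (hs h).elim
  filter_upwards [h] with c hc p hp i j hi hj
  by_contra hij
  have hs := A.prod_form_surjective hij hi hj
  rw [convexHull_insert ⟨a, by simp⟩, convexHull_pair, convexJoin_singleton_left] at hp
  obtain ⟨q, hq, hpq⟩ := Set.mem_iUnion₂.1 hp
  obtain ⟨r, s, hr, hs', hrs, rfl⟩ := hpq
  obtain ⟨r', s', hr', hs'', hrs', hq'⟩ := hq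
  let φ := realAffineMap ((A.form i).prod (A.form j))
  have h0 : r • φ c + s • φ q = 0 := by
    rw [← Convex.combo_affine_apply hrs]
    exact Prod.ext hi hj
  have h1 : φ q = r' • φ a + s' • φ b := by
    rw [← hq']
    exact Convex.combo_affine_apply hrs'
  rcases hr.eq_or_lt with rfl | hr
  · obtain rfl : s = 1 := by linarith
    rw [zero_smul, one_smul, zero_add] at hi
    exact A.mem_complement.1 (hab ⟨r', s', hr', hs'', hrs', hq'⟩) i hi
  · refine hc i j hs ?_
    have h2 : φ c = r⁻¹ • (-(s • φ q)) := by
      rw [← eq_neg_of_add_eq_zero_left h0, inv_smul_smul₀ hr.ne']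
    change φ c ∈ Submodule.span ℝ {φ a, φ b}
    rw [h2, h1]
    refine Submodule.smul_mem _ _ (Submodule.neg_mem _ (Submodule.smul_mem _ _
      (Submodule.add_mem _ (Submodule.smul_mem _ _ (Submodule.subset_span (by simp)))
        (Submodule.smul_mem _ _ (Submodule.subset_span (by simp))))))

end Arrangement

namespace PathCharacter

variable {A} {T : PathCharacter A.complement}

lemma flatNear_singleton (hT : T.TrivialOnCircles) {p : Fin ℓ → ℂ}
    (h : ∀ i j, A.form i p = 0 → A.form j p = 0 → i = j) : T.FlatNear {p} := by
  by_cases hp : p ∈ A.complement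
  · exact T.flatNear_of_mem_complement hp
  · rw [A.mem_complement] at hp
    push Not at hp
    obtain ⟨i, hi⟩ := hp
    exact flatNear_of_mem_hyperplane hT hi fun j hj hj0 => hj (h j i hj0 hi)

/-- The value `d` at `v` is obtained by continuing the value `1` at `c` along the segment. -/
def ContinuesTo (T : PathCharacter A.complement) (c v : A.complement) (d : ℂˣ) : Prop :=
  ∃ δ > 0, ∃ g, T.Flat g (Subtype.val ⁻¹' Metric.thickening δ (segment ℝ (c : Fin ℓ → ℂ) v)) ∧
    g c = 1 ∧ g v = d

lemma ContinuesTo.unique {c v : A.complement} {d d' : ℂˣ} (h : T.ContinuesTo c v d)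
    (h' : T.ContinuesTo c v d') : d = d' := by
  obtain ⟨δ, hδ, g, hg, hc, rfl⟩ := h
  obtain ⟨δ', hδ', g', hg', hc', rfl⟩ := h'
  have hmin : 0 < min δ δ' := lt_min hδ hδ'
  refine hg.eq_of_joinedIn hg' (hc.trans hc'.symm) ?_
  refine (A.joinedIn_preimage_of_convex (Metric.isOpen_thickening (δ := min δ δ'))
    ((convex_segment (c : Fin ℓ → ℂ) (v : Fin ℓ → ℂ)).thickening _)
    (Metric.self_subset_thickening hmin _ (left_mem_segment ℝ _ _))
    (Metric.self_subset_thickening hmin _ (right_mem_segment ℝ _ _))).mono ?_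
  exact fun x hx => ⟨Metric.thickening_mono (min_le_left _ _) _ hx,
    Metric.thickening_mono (min_le_right _ _) _ hx⟩

/-- The path `γ` may leave the thickened triangle. Since `T` is given by a flat function on the
ball, `γ` can be replaced by a path `η` with the same ends inside both the ball and the thickening.
-/
lemma exists_continuesTo_of_triangle {c a b : A.complement} {p : Fin ℓ → ℂ} {ε : ℝ}
    (hball : Metric.ball p ε ⊆ A.complement)
    (htri : T.FlatNear (convexHull ℝ {(c : Fin ℓ → ℂ), (a : Fin ℓ → ℂ), (b : Fin ℓ → ℂ)}))
    (γ : Path a b) (hγ : ∀ t, (γ t : Fin ℓ → ℂ) ∈ Metric.ball p ε) :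
    ∃ d, T.ContinuesTo c a d ∧ T.ContinuesTo c b (T.val γ * d) := by
  obtain ⟨δ, hδ, g, hg⟩ := htri
  have ha : (a : Fin ℓ → ℂ) ∈ Metric.ball p ε := by simpa using hγ 0
  have hb : (b : Fin ℓ → ℂ) ∈ Metric.ball p ε := by simpa using hγ 1
  obtain ⟨g', hg'⟩ := A.exists_flat_of_starConvex T
    ((convex_ball p ε).starConvex ha) ⟨_, ha⟩ hball
  have hmem : ∀ x ∈ ({(c : Fin ℓ → ℂ), (a : Fin ℓ → ℂ), (b : Fin ℓ → ℂ)} : Set _),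
      x ∈ Metric.thickening δ
        (convexHull ℝ {(c : Fin ℓ → ℂ), (a : Fin ℓ → ℂ), (b : Fin ℓ → ℂ)}) := fun x hx =>
    Metric.self_subset_thickening hδ _ (subset_convexHull ℝ _ hx)
  obtain ⟨η, hη⟩ := A.joinedIn_preimage_of_convex
    (Metric.isOpen_ball.inter (Metric.isOpen_thickening (δ := δ)
      (E := convexHull ℝ {(c : Fin ℓ → ℂ), (a : Fin ℓ → ℂ), (b : Fin ℓ → ℂ)})))
    ((convex_ball p ε).inter ((convex_convexHull ℝ _).thickening δ))
    (x := a) (y := b) ⟨ha, hmem _ (by simp)⟩ ⟨hb, hmem _ (by simp)⟩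
  have h1 : T.val γ = T.val η := by
    have h2 := (hg' γ hγ).symm.trans (hg' η fun t => (hη t).1)
    exact mul_right_cancel h2
  have hseg : ∀ v ∈ ({(c : Fin ℓ → ℂ), (a : Fin ℓ → ℂ), (b : Fin ℓ → ℂ)} : Set _),
      segment ℝ (c : Fin ℓ → ℂ) v ⊆
        convexHull ℝ {(c : Fin ℓ → ℂ), (a : Fin ℓ → ℂ), (b : Fin ℓ → ℂ)} := fun v hv =>
    segment_subset_convexHull (by simp) hv
  have hflat := hg.mul_const (g c)⁻¹
  refine ⟨g a * (g c)⁻¹, ⟨δ, hδ, fun x => g x * (g c)⁻¹, hflat.mono (Set.preimage_mono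
    (Metric.thickening_subset_of_subset δ (hseg _ (by simp)))), mul_inv_cancel _, rfl⟩,
    ⟨δ, hδ, fun x => g x * (g c)⁻¹, hflat.mono (Set.preimage_mono
    (Metric.thickening_subset_of_subset δ (hseg _ (by simp)))), mul_inv_cancel _, ?_⟩⟩
  rw [h1]
  exact hflat η fun t => (hη t).2

/-- A path character of the complement of an arrangement that is trivial on the meridian circles is
trivial on all loops. -/
theorem val_loop_eq_one (hT : T.TrivialOnCircles) {x : A.complement} (γ : Path x x) :
    T.val γ = 1 := by
  have hloc : ∀ s : unitInterval, ∃ ε > 0,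
      Metric.ball (γ s : Fin ℓ → ℂ) ε ⊆ A.complement := fun s =>
    Metric.isOpen_iff.1 A.isOpen_complement _ (γ s).2
  choose ε hε hball using hloc
  obtain ⟨t, ht0, htmono, ⟨N, hN⟩, ht⟩ := exists_monotone_Icc_subset_open_cover_unitInterval
    (c := fun s : unitInterval => (fun r => (γ r : Fin ℓ → ℂ)) ⁻¹' Metric.ball (γ s) (ε s))
    (fun s => Metric.isOpen_ball.preimage (by fun_prop))
    fun s _ => Set.mem_iUnion.2 ⟨s, Metric.mem_ball_self (hε s)⟩
  choose s hs using ht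
  have hsub : ∀ n r, (γ.subpath (t n) (t (n + 1)) r : Fin ℓ → ℂ) ∈
      Metric.ball (γ (s n) : Fin ℓ → ℂ) (ε (s n)) := by
    intro n r
    have h1 : γ.subpath (t n) (t (n + 1)) r ∈ Set.range (γ.subpath (t n) (t (n + 1))) := ⟨r, rfl⟩
    rw [Path.range_subpath_of_le _ _ _ (htmono n.le_succ)] at h1
    obtain ⟨r', hr', h2⟩ := h1
    rw [← h2]
    exact hs n hr'
  have hseg : ∀ n, segment ℝ (γ (t n) : Fin ℓ → ℂ) (γ (t (n + 1))) ⊆ A.complement := fun n =>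
    ((convex_ball _ _).segment_subset (by simpa using hsub n 0) (by simpa using hsub n 1)).trans
      (hball (s n))
  -- One apex serves all triangles at once, as countably many null sets are excluded.
  obtain ⟨c, -, hcA, hc⟩ := Arrangement.exists_mem_of_ae (A.ae_mem_complement.and
    (MeasureTheory.ae_all_iff.2 fun n => A.ae_triangle_meets_at_most_one _ _ (hseg n)))
    isOpen_univ Set.univ_nonempty
  have htri : ∀ n, ∃ d, T.ContinuesTo ⟨c, hcA⟩ (γ (t n)) d ∧
      T.ContinuesTo ⟨c, hcA⟩ (γ (t (n + 1))) (T.val (γ.subpath (t n) (t (n + 1))) * d) :=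
    fun n => exists_continuesTo_of_triangle (hball (s n))
      (flatNear_triangle fun p hp => flatNear_singleton hT (hc n p hp)) _ (hsub n)
  choose d hd hd' using htri
  have key : ∀ n, d n = T.val (γ.subpath 0 (t n)) * d 0 := by
    intro n
    induction n with
    | zero => rw [ht0, Path.subpath_self, val_refl, one_mul]
    | succ n ih =>
      rw [(hd (n + 1)).unique (hd' n), ih, ← mul_assoc, mul_comm (T.val _), val_subpath_mul]
  have h1 := key N
  rw [hN N le_rfl, val_subpath_zero_one] at h1
  have h2 : γ (t N) = γ (t 0) := by rw [hN N le_rfl, ht0, γ.source, γ.target]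
  -- The first and last division points coincide, so uniqueness of continuation from `c` forces `d N
  -- = d 0`.
  have h3 := hd N
  rw [h2] at h3
  rw [h3.unique (hd 0)] at h1
  exact mul_eq_right.1 h1.symm

end PathCharacter

namespace Arrangement

variable {A}

/-- The quotient `τ / τ'` is trivial on meridians. Closing a transverse circle up by chosen paths to
`x₀` gives a meridian, so its path character is trivial on circles. -/
theorem IsMeridianCharacter.unique {x₀ : A.complement} {k : ℕ}
    {τ τ' : FundamentalGroup A.complement x₀ →* ℂˣ} (h : A.IsMeridianCharacter x₀ k τ)
    (h' : A.IsMeridianCharacter x₀ k τ') : τ = τ' := by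
  have := A.pathConnectedSpace_complement x₀
  have hT : (PathCharacter.ofCharacter (τ / τ')).TrivialOnCircles := by
    intro i p v y σ hp hv hj hσ
    have hg : A.IsMeridian x₀ i (FundamentalGroup.fromPath (Path.Homotopic.Quotient.mk
      (((PathConnectedSpace.somePath x₀ y).trans σ).trans
        (PathConnectedSpace.somePath x₀ y).symm))) :=
      ⟨p, v, y, _, σ, hp, hv, hj, hσ, rfl⟩
    change (τ / τ') _ = 1
    rw [MonoidHom.div_apply, div_eq_one]
    exact Units.ext ((h i _ hg).trans (h' i _ hg).symm)
  refine MonoidHom.ext fun g => ?_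
  obtain ⟨γ, rfl⟩ := Path.Homotopic.Quotient.mk_surjective g
  have h1 := PathCharacter.val_loop_eq_one hT γ
  rw [PathCharacter.ofCharacter_loop, MonoidHom.div_apply, div_eq_one] at h1
  exact h1

end Arrangement

end Uniqueness

/-! ### Meridian values, existence, and the sum over divisors -/

section Meridian

lemma rootTransport_mk_mul {X : Type} [TopologicalSpace X] (f : C(X, PuncturedPlane)) {m : ℕ}
    (hm : 0 < m) {x y : X} (σ : Path x y) (z : C(unitInterval, PuncturedPlane))
    (hz : ∀ s, powMap m (z s) = f (σ s)) :
    (rootTransport f hm (x := .mk x) (y := .mk y) (Path.Homotopic.Quotient.mk σ) : ℂ) * (z 0 : ℂ) =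
      z 1 := by
  have h0 : powMap m (z 0) = f x := (hz 0).trans (congrArg f σ.source)
  have h1 : powMap m (z 1) = f y := (hz 1).trans (congrArg f σ.target)
  refine (monodromy_eq_rootTransport f hm (x := .mk x) (y := .mk y)
    (Path.Homotopic.Quotient.mk σ) ⟨z 0, h0⟩).symm.trans ?_
  have := (isCoveringMap_powMap hm).monodromy_eq_of_map_eq
    (γ := Path.Homotopic.Quotient.map (Path.Homotopic.Quotient.mk σ) f)
    (ex := ⟨z 0, h0⟩) (ey := ⟨z 1, h1⟩)
    (Path.Homotopic.Quotient.mk ⟨z, rfl, rfl⟩) (by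
      refine congrArg Path.Homotopic.Quotient.mk ?_
      apply Path.ext
      funext t
      exact hz t)
  exact congrArg (fun w => ((w.1 : PuncturedPlane) : ℂ)) this

lemma norm_div_lt_one_of_forall_add_mul_ne_zero {a b : ℂ} (h : ∀ t : ℂ, ‖t‖ ≤ 1 → a + t * b ≠ 0) :
    ‖b / a‖ < 1 := by
  have ha : a ≠ 0 := by simpa using h 0 (by simp)
  by_contra! hab
  have hb : b ≠ 0 := by
    rintro rfl
    simp at hab
    linarith
  refine h (-(b / a)⁻¹) ?_ ?_
  · rw [norm_neg, norm_inv]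
    exact inv_le_one_of_one_le₀ hab
  · field_simp
    ring

namespace Arrangement

variable {ι : Type} [Fintype ι] {ℓ : ℕ} (A : Arrangement ι ℓ) {m : ℕ} (hm : 0 < m)
  (x₀ : A.complement)

lemma form_add_smul (i : ι) (p v : Fin ℓ → ℂ) (t : ℂ) :
    A.form i (p + t • v) = A.form i p + t * (A.form i).linear v := by
  rw [add_comm p, ← vadd_eq_add, AffineMap.map_vadd, map_smul, vadd_eq_add, smul_eq_mul, add_comm]

/-- On the circle `f` is a constant times `e^(2πis)` times factors `1 + e^(2πis) β_j` with `|β_j| <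
1`. Those factors stay in the slit plane, so their principal roots return to their initial values;
only `e^(2πis/m)` contributes monodromy. -/
lemma exists_root_along_circle {i : ι} {p v : Fin ℓ → ℂ} (hp : p ∈ A.hyperplane i)
    (hv : (A.form i).linear v ≠ 0)
    (hj : ∀ j, j ≠ i → ∀ t : ℂ, ‖t‖ ≤ 1 → p + t • v ∉ A.hyperplane j) {m : ℕ} (hm : 0 < m) :
    ∃ z : C(unitInterval, PuncturedPlane),
      (∀ s, ((z s : ℂ)) ^ m =
        A.Q (p + Complex.exp (2 * Real.pi * Complex.I * (s : ℝ)) • v)) ∧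
      (z 1 : ℂ) = Complex.exp (2 * Real.pi * Complex.I / m) * z 0 := by
  classical
  have hlt : ∀ j, j ≠ i → ‖(A.form j).linear v / A.form j p‖ < 1 := fun j hji =>
    norm_div_lt_one_of_forall_add_mul_ne_zero fun t ht => by
      rw [← form_add_smul]
      exact hj j hji t ht
  have ha : ∀ j, j ≠ i → A.form j p ≠ 0 := fun j hji => by
    simpa [hyperplane] using hj j hji 0 (by simp)
  have hK : (A.form i).linear v * ∏ j ∈ Finset.univ.erase i, A.form j p ≠ 0 :=
    mul_ne_zero hv (Finset.prod_ne_zero_iff.2 fun j hj => ha j (Finset.ne_of_mem_erase hj))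
  obtain ⟨K, hKm⟩ := IsAlgClosed.exists_pow_nat_eq
    ((A.form i).linear v * ∏ j ∈ Finset.univ.erase i, A.form j p) hm
  have hK0 : K ≠ 0 := by
    rintro rfl
    exact hK (by rw [← hKm, zero_pow hm.ne'])
  let e : ℝ → ℂ := fun s => Complex.exp (2 * Real.pi * Complex.I * s)
  have he : ∀ s, ‖e s‖ = 1 := fun s => by
    have : e s = Complex.exp ((2 * Real.pi * s : ℝ) * Complex.I) := by
      simp only [e]
      congr 1
      push_cast
      ring
    rw [this, Complex.norm_exp_ofReal_mul_I]
  have hslit : ∀ j ∈ Finset.univ.erase i, ∀ s,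
      1 + e s * ((A.form j).linear v / A.form j p) ∈ Complex.slitPlane := fun j hj s => by
    apply Complex.mem_slitPlane_of_norm_lt_one
    rw [norm_mul, he, one_mul]
    exact hlt j (Finset.ne_of_mem_erase hj)
  let w : ℝ → ℂ := fun s => K * Complex.exp (2 * Real.pi * Complex.I / m * s) *
    ∏ j ∈ Finset.univ.erase i,
      (1 + e s * ((A.form j).linear v / A.form j p)) ^ ((m : ℂ)⁻¹)
  have hw : Continuous w := by
    refine Continuous.mul (by fun_prop) (continuous_finsetProd _ fun j hj => ?_)
    exact Continuous.cpow (by fun_prop) continuous_const (hslit j hj)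
  have hw0 : ∀ s, w s ≠ 0 := fun s => by
    refine mul_ne_zero (mul_ne_zero hK0 (Complex.exp_ne_zero _))
      (Finset.prod_ne_zero_iff.2 fun j hj => ?_)
    rw [Complex.cpow_ne_zero_iff]
    exact Or.inl (Complex.slitPlane_ne_zero (hslit j hj s))
  have hmC : (m : ℂ) ≠ 0 := Nat.cast_ne_zero.2 hm.ne'
  refine ⟨⟨fun s => ⟨w s, hw0 s⟩, by fun_prop⟩, fun s => ?_, ?_⟩
  · change (w s) ^ m = ∏ j, A.form j (p + e s • v)
    rw [← Finset.mul_prod_erase _ _ (Finset.mem_univ i)]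
    have h1 : A.form i (p + e s • v) = e s * (A.form i).linear v := by
      rw [form_add_smul, show A.form i p = 0 from hp, zero_add]
    have h2 : ∀ j ∈ Finset.univ.erase i, A.form j (p + e s • v) =
        A.form j p * (1 + e s * ((A.form j).linear v / A.form j p)) := fun j hj => by
      have := ha j (Finset.ne_of_mem_erase hj)
      rw [form_add_smul]
      field_simp
    rw [h1, Finset.prod_congr rfl h2, Finset.prod_mul_distrib]
    simp only [w]
    rw [mul_pow, mul_pow, hKm, ← Finset.prod_pow, ← Complex.exp_nat_mul]
    simp only [Complex.cpow_nat_inv_pow _ hm.ne']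
    rw [show (m : ℂ) * (2 * Real.pi * Complex.I / m * (s : ℝ)) =
      2 * Real.pi * Complex.I * (s : ℝ) by field_simp]
    simp only [e]
    ring
  · change w 1 = _ * w 0
    have h10 : e 1 = e 0 := by
      simp only [e, Complex.ofReal_one, mul_one, Complex.ofReal_zero, mul_zero,
        Complex.exp_two_pi_mul_I, Complex.exp_zero]
    simp only [w, h10, Complex.ofReal_one, mul_one, Complex.ofReal_zero, mul_zero, Complex.exp_zero]
    ring

lemma rootChar_meridian {i : ι} {g : FundamentalGroup A.complement x₀} (hg : A.IsMeridian x₀ i g) :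
    (A.rootChar hm x₀ g : ℂ) = Complex.exp (2 * Real.pi * Complex.I / m) := by
  obtain ⟨p, v, y, δ, σ, hp, hv, hj, hσ, rfl⟩ := hg
  obtain ⟨z, hz, hz1⟩ := A.exists_root_along_circle hp hv hj hm
  have hval : (rootTransport A.definingMap hm (x := .mk y) (y := .mk y)
      (Path.Homotopic.Quotient.mk σ) : ℂ) = Complex.exp (2 * Real.pi * Complex.I / m) := by
    refine mul_right_cancel₀ (z 0).ne_zero
      ((rootTransport_mk_mul A.definingMap hm σ z fun s => Subtype.ext ?_).trans hz1)
    change ((z s : ℂ)) ^ m = A.Q (σ s)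
    rw [hσ]
    exact hz s
  let d : FundamentalGroupoid.mk x₀ ⟶ FundamentalGroupoid.mk y := Path.Homotopic.Quotient.mk δ
  let c : FundamentalGroupoid.mk y ⟶ FundamentalGroupoid.mk y := Path.Homotopic.Quotient.mk σ
  have : A.rootChar hm x₀ (FundamentalGroup.fromPath
      (Path.Homotopic.Quotient.mk ((δ.trans σ).trans δ.symm))) =
      rootTransport A.definingMap hm ((d ≫ c) ≫ Groupoid.inv d) := rfl
  rw [this, rootTransport_comp, rootTransport_comp, rootTransport_inv, mul_comm,
    inv_mul_cancel_left]
  exact hval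

lemma isMeridianCharacter_rootChar_pow {k : ℕ} (hk : k ∣ m) :
    A.IsMeridianCharacter x₀ k (A.rootChar hm x₀ ^ (m / k)) := by
  intro i g hg
  rw [MonoidHom.pow_apply, Units.val_pow_eq_pow_val, A.rootChar_meridian hm x₀ hg,
    ← Complex.exp_nat_mul]
  congr 1
  obtain ⟨d, rfl⟩ := hk
  have hk0 : 0 < k := Nat.pos_of_mul_pos_right hm
  have hd0 : 0 < d := Nat.pos_of_mul_pos_left hm
  rw [Nat.mul_div_cancel_left _ hk0]
  have hk' : (k : ℂ) ≠ 0 := Nat.cast_ne_zero.2 hk0.ne'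
  have hd' : (d : ℂ) ≠ 0 := Nat.cast_ne_zero.2 hd0.ne'
  push_cast
  field_simp

theorem existsUnique_isMeridianCharacter {k : ℕ} (hk : 0 < k) :
    ∃! τ : FundamentalGroup A.complement x₀ →* ℂˣ, A.IsMeridianCharacter x₀ k τ :=
  -- The witness is the monodromy character of the `k`-th roots of `f`, to the power `k / k`.
  ⟨_, A.isMeridianCharacter_rootChar_pow hk x₀ dvd_rfl, fun _ h =>
    h.unique (A.isMeridianCharacter_rootChar_pow hk x₀ dvd_rfl)⟩

/-- The Betti numbers of a power of the monodromy system depend only on the order of the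
monodromy about the hyperplanes. -/
lemma bettiLocal_powSystem_eq_of_gcd_eq {a b : ℕ} (hab : m.gcd a = m.gcd b) (q : ℕ) :
    bettiLocal (A.powSystem hm x₀ a) q = bettiLocal (A.powSystem hm x₀ b) q := by
  have hζ := Complex.isPrimitiveRoot_exp m hm.ne'
  set ζ := Complex.exp (2 * Real.pi * Complex.I / m)
  have hfin : IsOfFinOrder ζ := isOfFinOrder_iff_pow_eq_one.2 ⟨m, hm, hζ.pow_eq_one⟩
  have hpow : ∀ c : ℕ, IsPrimitiveRoot (ζ ^ c) (m / m.gcd c) := fun c => by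
    have := IsPrimitiveRoot.orderOf (ζ ^ c)
    rwa [hfin.orderOf_pow, ← hζ.eq_orderOf] at this
  obtain ⟨σ, hσ⟩ := exists_ringEquiv_of_isPrimitiveRoot
    (Nat.div_pos (Nat.gcd_le_left a hm) (Nat.gcd_pos_of_pos_left a hm)) (hpow a)
    (by rw [hab]; exact hpow b)
  rw [bettiLocal_inducedSystem_conjugate σ]
  have : (Units.map (σ : ℂ →* ℂ)).comp (A.rootChar hm x₀ ^ a) = A.rootChar hm x₀ ^ b := by
    refine MonoidHom.ext fun g => Units.ext ?_
    have h1 : (A.rootChar hm x₀ g : ℂ) ^ m = 1 := by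
      rw [← Units.val_pow_eq_pow_val, rootCharacter_pow, Units.val_one]
    have : NeZero m := ⟨hm.ne'⟩
    -- All values of the character are powers of `ζ`, so `σ (ζ ^ a) = ζ ^ b` determines the
    -- conjugate of its `a`-th power.
    obtain ⟨r, -, hr⟩ := hζ.eq_pow_of_pow_eq_one h1
    change σ ((A.rootChar hm x₀ g : ℂ) ^ a) = (A.rootChar hm x₀ g : ℂ) ^ b
    rw [← hr, pow_right_comm, map_pow, hσ, pow_right_comm]
  rw [this]

theorem betti_cover_eq_sum_divisors (q : ℕ) :
    betti (A.cover m) q =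
      ∑ k ∈ m.divisors, (Nat.totient k : Cardinal.{0}) * bettiLocal (A.powSystem hm x₀ (m / k)) q := by
  have := A.pathConnectedSpace_complement x₀
  rw [A.betti_cover_eq_sum hm x₀ q,
    Fin.sum_univ_eq_sum_range (fun j => bettiLocal (A.powSystem hm x₀ j) q) m,
    -- The exponents `j < m` are grouped by `d = gcd(m, j)`; the fibre has `φ(m / d)` elements, and
    -- `k = m / d`. The exponent `j = 0` has gcd `m` and belongs to `k = 1`.
    ← Finset.sum_fiberwise_of_maps_to (t := m.divisors) (g := m.gcd)
      fun j _ => Nat.mem_divisors.2 ⟨m.gcd_dvd_left j, hm.ne'⟩,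
    ← Nat.sum_div_divisors m fun k =>
      (Nat.totient k : Cardinal.{0}) * bettiLocal (A.powSystem hm x₀ (m / k)) q]
  refine Finset.sum_congr rfl fun d hd => ?_
  have hdm := Nat.dvd_of_mem_divisors hd
  rw [Nat.div_div_self hdm hm.ne', Nat.totient_div_of_dvd hdm, ← nsmul_eq_mul, ← Finset.sum_const]
  refine Finset.sum_congr rfl fun j hj => A.bettiLocal_powSystem_eq_of_gcd_eq hm x₀ ?_ q
  rw [(Finset.mem_filter.1 hj).2, Nat.gcd_eq_right hdm]

end Arrangement

end Meridian

end CyclicCover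

end

theorem theorem4p5 {ι : Type} [Fintype ι] {ℓ : ℕ} (A : CyclicCover.Arrangement ι ℓ)
    (x₀ : A.complement) (m : ℕ) (hm : 0 < m) :
    -- for each `k ∣ m` there is exactly one character of `π₁(M(A), x₀)` with `γ_H ↦ exp(2πi/k)`
    (∀ k ∈ m.divisors, ∃! τ : FundamentalGroup A.complement x₀ →* ℂˣ,
      A.IsMeridianCharacter x₀ k τ) ∧
    -- `b_q(X_m(A)) = ∑_{k ∣ m} φ(k) · dim H^q(M(A); L^k_1)`
    ∀ τ : ℕ → (FundamentalGroup A.complement x₀ →* ℂˣ),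
      (∀ k ∈ m.divisors, A.IsMeridianCharacter x₀ k (τ k)) →
      ∀ q : ℕ, CyclicCover.betti (A.cover m) q =
        ∑ k ∈ m.divisors,
          (Nat.totient k : Cardinal.{0}) *
            CyclicCover.bettiLocal (CyclicCover.inducedSystem (τ k)) q := by
  refine ⟨fun k hk => A.existsUnique_isMeridianCharacter x₀ (Nat.pos_of_mem_divisors hk),
    fun τ hτ q => ?_⟩
  rw [A.betti_cover_eq_sum_divisors hm x₀ q]
  refine Finset.sum_congr rfl fun k hk => ?_
  rw [(hτ k hk).unique (A.isMeridianCharacter_rootChar_pow hm x₀ (Nat.dvd_of_mem_divisors hk))]
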